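/- Let $A\in\mathbb{R}^{n\times n}$, $B\in\mathbb{R}^{n\times m}$, $C\in\mathbb{R}^{n\times p}$, let $d\in\mathbb{R}^p$ be a constant disturbance, let $Q\in\mathbb{R}^{n\times n}$ be symmetric positive semidefinite and $R\in\mathbb{R}^{m\times m}$ symmetric positive definite, and put $f(y,u)=\tfrac12\,(y^TQy+u^TRu)$. A real square matrix is Hurwitz if all its eigenvalues have negative real part. The pair $(A,B)$ is stabilizable if there is an invertible $T$ with $$T^{-1}AT=\begin{bmatrix}A_c&A_{12}\\ 0&A_u\end{bmatrix},\qquad T^{-1}B=\begin{bmatrix}B_c\\ 0\end{bmatrix},$$ where $(A_c,B_c)$ is controllable (every initial state of $\dot z=A_cz+B_cv$ can be steered to the origin in finite time by some input $v$) and $A_u$ is Hurwitz; either diagonal block may be empty. The pair $(A,Q)$ is detectable if $(A^T,Q^T)$ is stabilizable. Assume that $(A,B)$ is stabilizable and $(A,Q)$ is detectable. Consider the system $\dot x=Ax+Bu+Cd$ on $[0,\infty)$ with $x(0)=x_0$ and piecewise continuous inputs $u:[0,\infty)\to\mathbb{R}^m$; the trajectory $x$ is continuous and satisfies the equation at every point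 of continuity of $u$. A control $u$ with trajectory $x$ is admissible (from $x_0$) if $u$ and $x$ are piecewise continuous and bounded on $[0,\infty)$. For $T>0$ let $J_T(x_0,u)=\int_0^T f(x(t),u(t))\,dt$. A control $u^*$ is overtaking optimal from $x_0$ if it is admissible and $$\limsup_{T\to\infty}\{J_T(x_0,u^*)-J_T(x_0,u)\}\le 0$$ (the upper limit being taken in $[-\infty,\infty]$) for every control $u$ admissible from $x_0$. Then: 1. The problem of minimizing $f(y,u)$ over all $(y,u)\in\mathbb{R}^n\times\mathbb{R}^m$ with $Ay+Bu+Cd=0$ has a unique optimal solution $(\bar x,\bar u)$. 2. The algebraic Riccati equation $PA+A^TP-PBR^{-1}B^TP+Q=0$ has a unique symmetric positive semidefinite solution $P^*$. 3. Put $K=R^{-1}B^TP^*$. For every initial state $x_0\in\mathbb{R}^n$, the closed-loop system under the feedback $u=-K(x-\bar x)+\bar u$ has a trajectory $x$ on $[0,\infty)$ with $x(0)=x_0$, and for every such trajectory the control $u^*(t)=-K(x(t)-\bar x)+\bar u$ is overtaking optimal from $x_0$. -/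

import Mathlib

open Filter Topology MeasureTheory Matrix

noncomputable section

namespace OvertakingLQ

/-- A real square matrix is Hurwitz if all its (complex) eigenvalues have negative real part. -/
def IsHurwitz {n : ℕ} (M : Matrix (Fin n) (Fin n) ℝ) : Prop :=
  ∀ μ : ℂ, Module.End.HasEigenvalue (Matrix.toLin' (M.map (algebraMap ℝ ℂ))) μ → μ.re < 0

/-- The controllable subspace of `ẋ = A x + B u`: the initial states that some input steers to the
origin at some time `t > 0`, expressed through the variation of constants formula. -/
def controllableSet {n m : ℕ} (A : Matrix (Fin n) (Fin n) ℝ) (B : Matrix (Fin n) (Fin m) ℝ) :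
    Set (Fin n → ℝ) :=
  {x | ∃ t : ℝ, 0 < t ∧ ∃ u : ℝ → Fin m → ℝ, IntervalIntegrable u volume 0 t ∧
    NormedSpace.exp (t • A) *ᵥ x
      + ∫ τ in (0 : ℝ)..t, NormedSpace.exp ((t - τ) • A) *ᵥ (B *ᵥ u τ) = 0}

/-- `(A, B)` is controllable: every state can be steered to the origin. -/
def IsControllable {n m : ℕ} (A : Matrix (Fin n) (Fin n) ℝ) (B : Matrix (Fin n) (Fin m) ℝ) :
    Prop :=
  controllableSet A B = Set.univ

/-- `(A, B)` is stabilizable: in a controllability decomposition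
`T⁻¹ A T = [[Ac, A12], [0, Au]]`, `T⁻¹ B = [[Bc], [0]]` with `(Ac, Bc)` controllable,
the uncontrollable block `Au` is Hurwitz. Here `S` is the inverse of `T`, and either block may be
empty. -/
def IsStabilizable {n m : ℕ} (A : Matrix (Fin n) (Fin n) ℝ) (B : Matrix (Fin n) (Fin m) ℝ) :
    Prop :=
  ∃ (k l : ℕ) (T : Matrix (Fin n) (Fin k ⊕ Fin l) ℝ) (S : Matrix (Fin k ⊕ Fin l) (Fin n) ℝ)
    (Ac : Matrix (Fin k) (Fin k) ℝ) (A12 : Matrix (Fin k) (Fin l) ℝ)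
    (Au : Matrix (Fin l) (Fin l) ℝ) (Bc : Matrix (Fin k) (Fin m) ℝ),
    T * S = 1 ∧ S * T = 1 ∧
    S * A * T = Matrix.fromBlocks Ac A12 0 Au ∧
    S * B = Matrix.fromRows Bc 0 ∧
    IsControllable Ac Bc ∧ IsHurwitz Au

/-- `(A, C)` is detectable if `(Aᵀ, Cᵀ)` is stabilizable. -/
def IsDetectable {n q : ℕ} (A : Matrix (Fin n) (Fin n) ℝ) (C : Matrix (Fin q) (Fin n) ℝ) :
    Prop :=
  IsStabilizable Aᵀ Cᵀ

/-- The quadratic cost `f(y, u) = (yᵀ Q y + uᵀ R u) / 2`. -/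
def cost {n m : ℕ} (Q : Matrix (Fin n) (Fin n) ℝ) (R : Matrix (Fin m) (Fin m) ℝ)
    (y : Fin n → ℝ) (u : Fin m → ℝ) : ℝ :=
  (1 / 2) * (y ⬝ᵥ (Q *ᵥ y) + u ⬝ᵥ (R *ᵥ u))

/-- `(xbar, ubar)` minimizes the cost among all steady states `A y + B u + C d = 0`. -/
def IsOptimalSteadyState {n m p : ℕ} (A : Matrix (Fin n) (Fin n) ℝ) (B : Matrix (Fin n) (Fin m) ℝ)
    (C : Matrix (Fin n) (Fin p) ℝ) (d : Fin p → ℝ)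
    (Q : Matrix (Fin n) (Fin n) ℝ) (R : Matrix (Fin m) (Fin m) ℝ)
    (xbar : Fin n → ℝ) (ubar : Fin m → ℝ) : Prop :=
  A *ᵥ xbar + B *ᵥ ubar + C *ᵥ d = 0 ∧
  ∀ (y : Fin n → ℝ) (u : Fin m → ℝ), A *ᵥ y + B *ᵥ u + C *ᵥ d = 0 →
    cost Q R xbar ubar ≤ cost Q R y u

/-- `P` is a positive semidefinite solution of the algebraic Riccati equation
`P A + Aᵀ P - P B R⁻¹ Bᵀ P + Q = 0`. -/
def IsPSDRiccatiSolution {n m : ℕ} (A : Matrix (Fin n) (Fin n) ℝ) (B : Matrix (Fin n) (Fin m) ℝ)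
    (Q : Matrix (Fin n) (Fin n) ℝ) (R : Matrix (Fin m) (Fin m) ℝ)
    (P : Matrix (Fin n) (Fin n) ℝ) : Prop :=
  P.PosSemidef ∧ P * A + Aᵀ * P - P * B * R⁻¹ * Bᵀ * P + Q = 0

/-- Piecewise continuity on `[0, ∞)`: finitely many discontinuities in every bounded interval, and
all one-sided limits exist. Values at negative times are irrelevant. -/
def PiecewiseContinuous {k : ℕ} (v : ℝ → Fin k → ℝ) : Prop :=
  (∀ T : ℝ, {t | t ∈ Set.Icc 0 T ∧ ¬ ContinuousWithinAt v (Set.Ici 0) t}.Finite) ∧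
  (∀ t : ℝ, 0 ≤ t → ∃ l, Tendsto v (𝓝[>] t) (𝓝 l)) ∧
  (∀ t : ℝ, 0 < t → ∃ l, Tendsto v (𝓝[<] t) (𝓝 l))

/-- The space `L∞` of piecewise continuous functions bounded on `[0, ∞)`. (The norm on
`Fin k → ℝ` is equivalent to the Euclidean one, so it gives the same bounded functions.) -/
def MemLinfty {k : ℕ} (v : ℝ → Fin k → ℝ) : Prop :=
  PiecewiseContinuous v ∧ ∃ M : ℝ, ∀ t : ℝ, 0 ≤ t → ‖v t‖ ≤ M

/-- `x` is the trajectory on `[0, ∞)` of `ẋ = A x + B u + C d`, `x 0 = x0`, for the piecewise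
continuous input `u`: it is continuous and solves the equation wherever `u` is continuous (with the
one-sided derivative at `t = 0`). -/
def IsTrajectory {n m p : ℕ} (A : Matrix (Fin n) (Fin n) ℝ) (B : Matrix (Fin n) (Fin m) ℝ)
    (C : Matrix (Fin n) (Fin p) ℝ) (d : Fin p → ℝ) (x0 : Fin n → ℝ)
    (u : ℝ → Fin m → ℝ) (x : ℝ → Fin n → ℝ) : Prop :=
  PiecewiseContinuous u ∧ x 0 = x0 ∧ ContinuousOn x (Set.Ici 0) ∧
  ∀ t : ℝ, 0 ≤ t → ContinuousWithinAt u (Set.Ici 0) t →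
    HasDerivWithinAt x (A *ᵥ x t + B *ᵥ u t + C *ᵥ d) (Set.Ici 0) t

/-- The control `u`, with trajectory `x` starting at `x0`, is admissible: both are in `L∞`. -/
def IsAdmissible {n m p : ℕ} (A : Matrix (Fin n) (Fin n) ℝ) (B : Matrix (Fin n) (Fin m) ℝ)
    (C : Matrix (Fin n) (Fin p) ℝ) (d : Fin p → ℝ) (x0 : Fin n → ℝ)
    (u : ℝ → Fin m → ℝ) (x : ℝ → Fin n → ℝ) : Prop :=
  IsTrajectory A B C d x0 u x ∧ MemLinfty u ∧ MemLinfty x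

/-- The finite-horizon performance index `J_T = ∫₀ᵀ f(x(t), u(t)) dt`. -/
def performanceIndex {n m : ℕ} (Q : Matrix (Fin n) (Fin n) ℝ) (R : Matrix (Fin m) (Fin m) ℝ)
    (x : ℝ → Fin n → ℝ) (u : ℝ → Fin m → ℝ) (T : ℝ) : ℝ :=
  ∫ t in (0 : ℝ)..T, cost Q R (x t) (u t)

/-- The control `us`, with trajectory `xs` starting at `x0`, is overtaking optimal: it is admissible
and `limsup_{T → ∞} (J_T(x0, us) - J_T(x0, u)) ≤ 0` for every admissible control `u` from the same
initial state. The upper limit is taken in the extended reals. -/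
def IsOvertakingOptimal {n m p : ℕ} (A : Matrix (Fin n) (Fin n) ℝ) (B : Matrix (Fin n) (Fin m) ℝ)
    (C : Matrix (Fin n) (Fin p) ℝ) (d : Fin p → ℝ)
    (Q : Matrix (Fin n) (Fin n) ℝ) (R : Matrix (Fin m) (Fin m) ℝ) (x0 : Fin n → ℝ)
    (us : ℝ → Fin m → ℝ) (xs : ℝ → Fin n → ℝ) : Prop :=
  IsAdmissible A B C d x0 us xs ∧
  ∀ (u : ℝ → Fin m → ℝ) (x : ℝ → Fin n → ℝ), IsAdmissible A B C d x0 u x →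
    limsup (fun T : ℝ =>
      ((performanceIndex Q R xs us T - performanceIndex Q R x u T : ℝ) : EReal)) atTop ≤ 0

/-- The input `t ↦ -K (x t - xbar) + ubar` generated along `x` by the feedback law with gain
`K = R⁻¹ Bᵀ P`. -/
def feedback {n m : ℕ} (B : Matrix (Fin n) (Fin m) ℝ) (R : Matrix (Fin m) (Fin m) ℝ)
    (P : Matrix (Fin n) (Fin n) ℝ) (xbar : Fin n → ℝ) (ubar : Fin m → ℝ)
    (x : ℝ → Fin n → ℝ) : ℝ → Fin m → ℝ :=
  fun t => -((R⁻¹ * Bᵀ * P) *ᵥ (x t - xbar)) + ubar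

end OvertakingLQ

end

open OvertakingLQ

namespace OvertakingLQ

/-! Stabilizability and detectability enter only through `HautusTest`, for `(A, B)` and for `(Aᵀ,
Qᵀ)`. Everything else is quadratic forms and compactness. Write `S = B R⁻¹ Bᵀ`.

Existence for the Riccati equation: the positive semidefinite `P` with `riccati A S Q P ≥ 0` form a
compact set containing `0`. It is bounded because a normalised limit of an unbounded sequence would
be a nonzero `X ≥ 0` with `Bᵀ X = 0` and `X A + Aᵀ X ≥ 0`, which the Hautus test forbids
(`HautusTest.eq_zero_of_posSemidef`). A trace maximiser is a solution, since an implicit Euler step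
of the Riccati flow from it produces a larger subsolution unless the residual is zero
(`exists_riccati_implicit_step`). Detectability makes `F = A - S P` stable. The case `S = 0`, `Q =
1` of the same existence theorem then yields a Lyapunov matrix for `F`, and comparing two solutions
gives uniqueness.

Steady state: once the control is eliminated, the Lagrange conditions form a square linear system
that is injective by the two Hautus tests. Its solution provides a multiplier `l`, and the cost
expands exactly around it.

Optimality: with `e = x - xbar`, put `V = 1/2 eᵀ P e + l ⬝ᵥ e`. Completing squares gives `J_T = T
f(xbar, ubar) + 1/2 G(T) + V(x 0) - V(x T)`, where `G` is the accumulated squared deviation from the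
feedback law and vanishes for the feedback itself. The difference of indices is therefore `V(x T) -
V(xs T) - 1/2 G(T)`, and `V(xs T) → 0`. If `G` is bounded, then `x → xbar`
(`tendsto_of_defectIntegral_bounded`) and `V(x T) → 0` as well. If `G` is unbounded, boundedness of
`x` makes the difference eventually negative. -/

/-- The Popov–Belevitch–Hautus test: no left eigenvector of `A` whose eigenvalue lies in the closed
right half-plane is annihilated by `B`. -/
def HautusTest {n m : ℕ} (A : Matrix (Fin n) (Fin n) ℝ) (B : Matrix (Fin n) (Fin m) ℝ) : Prop :=
  ∀ (μ : ℂ) (z : Fin n → ℂ), 0 ≤ μ.re → Aᵀ.map (algebraMap ℝ ℂ) *ᵥ z = μ • z →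
    Bᵀ.map (algebraMap ℝ ℂ) *ᵥ z = 0 → z = 0

/-! ### Complexification, and the Hautus test from stabilizability. -/

theorem re_map_mulVec {ι κ : Type*} [Fintype κ] (M : Matrix ι κ ℝ) (z : κ → ℂ) :
    (fun i => ((M.map (algebraMap ℝ ℂ) *ᵥ z) i).re) = M *ᵥ (fun j => (z j).re) := by
  ext i; simp [Matrix.mulVec, dotProduct]

theorem im_map_mulVec {ι κ : Type*} [Fintype κ] (M : Matrix ι κ ℝ) (z : κ → ℂ) :
    (fun i => ((M.map (algebraMap ℝ ℂ) *ᵥ z) i).im) = M *ᵥ (fun j => (z j).im) := by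
  ext i; simp [Matrix.mulVec, dotProduct]

theorem map_mulVec_ofReal {ι κ : Type*} [Fintype κ] (M : Matrix ι κ ℝ) (x : κ → ℝ) :
    M.map (algebraMap ℝ ℂ) *ᵥ (fun j => (x j : ℂ)) = fun i => (((M *ᵥ x) i : ℝ) : ℂ) := by
  ext i; simp [Matrix.mulVec, dotProduct]

theorem map_mul_mulVec {ι κ l : Type*} [Fintype κ] [Fintype l] (M : Matrix ι κ ℝ)
    (N : Matrix κ l ℝ) (z : l → ℂ) :
    (M * N).map (algebraMap ℝ ℂ) *ᵥ z =
      M.map (algebraMap ℝ ℂ) *ᵥ (N.map (algebraMap ℝ ℂ) *ᵥ z) := by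
  rw [Matrix.map_mul, ← Matrix.mulVec_mulVec]

theorem IsHurwitz.eq_zero_of_transpose {n : ℕ} {M : Matrix (Fin n) (Fin n) ℝ} (hM : IsHurwitz M)
    {μ : ℂ} {z : Fin n → ℂ} (hμ : 0 ≤ μ.re) (hz : Mᵀ.map (algebraMap ℝ ℂ) *ᵥ z = μ • z) :
    z = 0 := by
  by_contra hne
  have h1 : Module.End.HasEigenvalue (Matrix.toLin' (Mᵀ.map (algebraMap ℝ ℂ))) μ :=
    Module.End.hasEigenvalue_of_hasEigenvector (x := z)
      ⟨Module.End.mem_eigenspace_iff.2 (by simpa using hz), hne⟩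
  have h2 : Module.End.HasEigenvalue (Matrix.toLin' (M.map (algebraMap ℝ ℂ))) μ := by
    rw [Module.End.hasEigenvalue_iff_mem_spectrum, Matrix.spectrum_toLin',
      Matrix.mem_spectrum_iff_isRoot_charpoly] at h1 ⊢
    rwa [Matrix.transpose_map, Matrix.charpoly_transpose] at h1
  exact absurd (hM μ h2) (not_lt.2 hμ)

/-- The real-linear functional `x ↦ ∑ zᵢ xᵢ` with complex coefficients. -/
noncomputable def complexFunctional {n : ℕ} (z : Fin n → ℂ) : (Fin n → ℝ) →L[ℝ] ℂ :=
  LinearMap.toContinuousLinearMap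
    { toFun := fun x => z ⬝ᵥ (fun i => (x i : ℂ))
      map_add' := fun x y => by
        simp only [dotProduct, ← Finset.sum_add_distrib]
        exact Finset.sum_congr rfl fun i _ => by simp [mul_add]
      map_smul' := fun c x => by
        simp only [dotProduct, Finset.smul_sum]
        exact Finset.sum_congr rfl fun i _ => by simp; ring }

theorem complexFunctional_apply {n : ℕ} (z : Fin n → ℂ) (x : Fin n → ℝ) :
    complexFunctional z x = z ⬝ᵥ (fun i => (x i : ℂ)) := rfl

theorem complexFunctional_mulVec {n k : ℕ} (M : Matrix (Fin n) (Fin k) ℝ) (z : Fin n → ℂ)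
    (x : Fin k → ℝ) :
    complexFunctional z (M *ᵥ x) = complexFunctional (Mᵀ.map (algebraMap ℝ ℂ) *ᵥ z) x := by
  rw [complexFunctional_apply, complexFunctional_apply, ← map_mulVec_ofReal,
    Matrix.dotProduct_mulVec, Matrix.transpose_map, Matrix.mulVec_transpose]

theorem complexFunctional_smul {n : ℕ} (c : ℂ) (z : Fin n → ℂ) (x : Fin n → ℝ) :
    complexFunctional (c • z) x = c * complexFunctional z x := by
  simp [complexFunctional_apply]

open scoped Matrix.Norms.Operator in
theorem complexFunctional_exp {n : ℕ} (A : Matrix (Fin n) (Fin n) ℝ) {μ : ℂ} {z : Fin n → ℂ}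
    (hz : Aᵀ.map (algebraMap ℝ ℂ) *ᵥ z = μ • z) (s : ℝ) (x : Fin n → ℝ) :
    complexFunctional z (NormedSpace.exp (s • A) *ᵥ x) =
      Complex.exp (s * μ) * complexFunctional z x := by
  have hpow : ∀ k : ℕ, complexFunctional z ((A ^ k) *ᵥ x) = μ ^ k * complexFunctional z x := by
    intro k
    induction k with
    | zero => simp
    | succ k ih =>
      rw [pow_succ', ← Matrix.mulVec_mulVec, complexFunctional_mulVec, hz, complexFunctional_smul,
        ih, pow_succ']
      ring
  let L : Matrix (Fin n) (Fin n) ℝ →L[ℝ] ℂ := (complexFunctional z).comp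
    (LinearMap.toContinuousLinearMap ((Matrix.mulVecBilin ℝ ℝ).flip x))
  have hL : ∀ M, L M = complexFunctional z (M *ᵥ x) := fun M => rfl
  have h1 := (NormedSpace.exp_series_hasSum_exp' (𝕂 := ℝ) (s • A)).mapL L
  have h2 := (NormedSpace.exp_series_hasSum_exp' (𝕂 := ℂ) ((s : ℂ) * μ)).mul_right
    (complexFunctional z x)
  rw [← hL, Complex.exp_eq_exp_ℂ]
  have e : ∀ k : ℕ, L ((k.factorial : ℝ)⁻¹ • (s • A) ^ k) =
      (k.factorial : ℂ)⁻¹ • ((s : ℂ) * μ) ^ k * complexFunctional z x := by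
    intro k
    rw [smul_pow, map_smul, map_smul, hL, hpow]
    simp [mul_pow]
    ring
  simp_rw [e] at h1
  exact h1.unique h2

/-- A left eigenvector `z` killed by `Bᵀ` does not see the input: applied to the state at time `t`,
the functional of `z` gives `exp (t μ)` times its initial value. Steering to the origin forces that
value to be zero. -/
theorem IsControllable.hautusTest {n m : ℕ} {A : Matrix (Fin n) (Fin n) ℝ}
    {B : Matrix (Fin n) (Fin m) ℝ} (h : IsControllable A B) : HautusTest A B := by
  intro μ z _ hz hB
  have key : ∀ x, complexFunctional z x = 0 := by
    intro x
    obtain ⟨t, -, u, -, hx⟩ : x ∈ controllableSet A B := h ▸ Set.mem_univ x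
    have hI : complexFunctional z
        (∫ τ in (0 : ℝ)..t, NormedSpace.exp ((t - τ) • A) *ᵥ (B *ᵥ u τ)) = 0 := by
      -- A non-integrable integrand has integral `0` by convention, so both cases give zero.
      by_cases hi : IntervalIntegrable
        (fun τ => NormedSpace.exp ((t - τ) • A) *ᵥ (B *ᵥ u τ)) volume 0 t
      · rw [← (complexFunctional z).intervalIntegral_comp_comm hi]
        refine (intervalIntegral.integral_congr (g := fun _ => 0) fun τ _ => ?_).trans (by simp)
        show complexFunctional z _ = 0
        rw [complexFunctional_exp A hz, complexFunctional_mulVec, hB]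
        simp [complexFunctional_apply]
      · rw [intervalIntegral.integral_undef hi, map_zero]
    have := congrArg (complexFunctional z) hx
    rw [map_add, hI, complexFunctional_exp A hz, add_zero, map_zero] at this
    exact (mul_eq_zero.1 this).resolve_left (Complex.exp_ne_zero _)
  ext i
  have := key (Pi.single i 1)
  rw [complexFunctional_apply] at this
  have h2 : (fun j => ((Pi.single i (1 : ℝ) : Fin n → ℝ) j : ℂ)) = Pi.single i 1 := by
    ext j; by_cases hj : j = i
    · subst hj; simp
    · simp [hj]
  simpa [h2] using this

/-- In the decomposed coordinates the transposed matrix is block lower triangular. The controllable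
component of the eigenvector vanishes first; what remains is an eigenvector of `Auᵀ`, excluded
because `Au` is Hurwitz. -/
theorem IsStabilizable.hautusTest {n m : ℕ} {A : Matrix (Fin n) (Fin n) ℝ}
    {B : Matrix (Fin n) (Fin m) ℝ} (h : IsStabilizable A B) : HautusTest A B := by
  obtain ⟨k, l, T, S, Ac, A12, Au, Bc, hTS, hST, hA, hB, hc, hu⟩ := h
  intro μ z hμ hz hBz
  set w : Fin k ⊕ Fin l → ℂ := Tᵀ.map (algebraMap ℝ ℂ) *ᵥ z with hw
  have hSw : Sᵀ.map (algebraMap ℝ ℂ) *ᵥ w = z := by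
    rw [hw, ← map_mul_mulVec, ← Matrix.transpose_mul, hTS]
    simp [Matrix.map_one]
  have h1 : (Matrix.fromBlocks Ac A12 0 Au)ᵀ.map (algebraMap ℝ ℂ) *ᵥ w = μ • w := by
    rw [← hA, Matrix.transpose_mul, Matrix.transpose_mul, map_mul_mulVec, map_mul_mulVec, hSw, hz,
      Matrix.mulVec_smul]
  have h2 : (Matrix.fromRows Bc (0 : Matrix (Fin l) (Fin m) ℝ))ᵀ.map (algebraMap ℝ ℂ) *ᵥ w = 0 := by
    rw [← hB, Matrix.transpose_mul, map_mul_mulVec, hSw, hBz]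
  have hc1 : Acᵀ.map (algebraMap ℝ ℂ) *ᵥ (w ∘ Sum.inl) = μ • (w ∘ Sum.inl) := by
    ext i
    have := congrFun h1 (Sum.inl i)
    simpa [Matrix.mulVec, dotProduct] using this
  have hc2 : Bcᵀ.map (algebraMap ℝ ℂ) *ᵥ (w ∘ Sum.inl) = 0 := by
    ext i
    have := congrFun h2 i
    simpa [Matrix.mulVec, dotProduct] using this
  have hc0 := hc.hautusTest μ _ hμ hc1 hc2
  have hu1 : Auᵀ.map (algebraMap ℝ ℂ) *ᵥ (w ∘ Sum.inr) = μ • (w ∘ Sum.inr) := by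
    ext i
    have := congrFun h1 (Sum.inr i)
    have h0 : ∀ j, w (Sum.inl j) = 0 := fun j => congrFun hc0 j
    simpa [Matrix.mulVec, dotProduct, h0] using this
  have hu0 := hu.eq_zero_of_transpose hμ hu1
  have hw0 : w = 0 := by
    ext i
    rcases i with i | i
    · exact congrFun hc0 i
    · exact congrFun hu0 i
  rw [← hSw, hw0, Matrix.mulVec_zero]

/-! ### Real quadratic forms and Lyapunov comparison. -/

theorem dotProduct_transpose_mulVec {ι κ : Type*} [Fintype ι] [Fintype κ] (M : Matrix ι κ ℝ)
    (x : κ → ℝ) (y : ι → ℝ) : x ⬝ᵥ (Mᵀ *ᵥ y) = y ⬝ᵥ (M *ᵥ x) := by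
  rw [Matrix.mulVec_transpose, dotProduct_comm, ← Matrix.dotProduct_mulVec]

theorem posSemidef_iff_real {n : ℕ} {M : Matrix (Fin n) (Fin n) ℝ} :
    M.PosSemidef ↔ Mᵀ = M ∧ ∀ x, 0 ≤ x ⬝ᵥ (M *ᵥ x) := by
  rw [Matrix.posSemidef_iff_dotProduct_mulVec]
  simp [Matrix.IsHermitian, Matrix.conjTranspose_eq_transpose_of_trivial]

theorem posDef_iff_real {n : ℕ} {M : Matrix (Fin n) (Fin n) ℝ} :
    M.PosDef ↔ Mᵀ = M ∧ ∀ x, x ≠ 0 → 0 < x ⬝ᵥ (M *ᵥ x) := by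
  rw [Matrix.posDef_iff_dotProduct_mulVec]
  simp [Matrix.IsHermitian, Matrix.conjTranspose_eq_transpose_of_trivial]

theorem _root_.Matrix.PosSemidef.mulVec_eq_zero_of_le {n : ℕ} {M : Matrix (Fin n) (Fin n) ℝ}
    (hM : M.PosSemidef) {x : Fin n → ℝ} (hx : x ⬝ᵥ (M *ᵥ x) ≤ 0) : M *ᵥ x = 0 :=
  (hM.dotProduct_mulVec_zero_iff x).1 (le_antisymm (by simpa using hx)
    (hM.dotProduct_mulVec_nonneg x))

/-- The Lyapunov operator evaluated as a quadratic form. -/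
theorem dotProduct_lyapunov {n : ℕ} {X : Matrix (Fin n) (Fin n) ℝ} (hX : Xᵀ = X)
    (F : Matrix (Fin n) (Fin n) ℝ) (x : Fin n → ℝ) :
    x ⬝ᵥ ((X * F + Fᵀ * X) *ᵥ x) = 2 * ((X *ᵥ x) ⬝ᵥ (F *ᵥ x)) := by
  rw [Matrix.add_mulVec, dotProduct_add, ← Matrix.mulVec_mulVec, ← Matrix.mulVec_mulVec,
    dotProduct_transpose_mulVec F x (X *ᵥ x), ← dotProduct_transpose_mulVec X, hX,
    dotProduct_comm (F *ᵥ x)]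
  ring

theorem continuous_dotProduct_mulVec {n : ℕ} (M : Matrix (Fin n) (Fin n) ℝ) :
    Continuous fun x : Fin n → ℝ => x ⬝ᵥ (M *ᵥ x) := by
  fun_prop

theorem smul_dotProduct_mulVec_smul {n : ℕ} (M : Matrix (Fin n) (Fin n) ℝ) (c : ℝ)
    (x : Fin n → ℝ) : (c • x) ⬝ᵥ (M *ᵥ (c • x)) = c ^ 2 * (x ⬝ᵥ (M *ᵥ x)) := by
  rw [Matrix.mulVec_smul, smul_dotProduct, dotProduct_smul]
  simp [sq, mul_assoc]

/-- If `Z` is a strict Lyapunov matrix of `F`, a symmetric `D` with `D F + Fᵀ D ≥ 0` is negative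
semidefinite. -/
theorem posSemidef_neg_of_lyapunov {n : ℕ} {Z F D : Matrix (Fin n) (Fin n) ℝ} (hZ : Z.PosDef)
    (hF : ∀ x, x ≠ 0 → x ⬝ᵥ ((Z * F + Fᵀ * Z) *ᵥ x) < 0) (hD : Dᵀ = D)
    (hDF : ∀ x, 0 ≤ x ⬝ᵥ ((D * F + Fᵀ * D) *ᵥ x)) : (-D).PosSemidef := by
  obtain ⟨hZs, hZp⟩ := posDef_iff_real.1 hZ
  rw [posSemidef_iff_real]
  refine ⟨by rw [Matrix.transpose_neg, hD], ?_⟩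
  by_contra! hcon
  obtain ⟨y, hy⟩ := hcon
  rw [Matrix.neg_mulVec, dotProduct_neg, neg_lt_zero] at hy
  have hy0 : y ≠ 0 := by rintro rfl; simp at hy
  have hne : ‖y‖ ≠ 0 := norm_ne_zero_iff.2 hy0
  have hsph : ∀ x ∈ Metric.sphere (0 : Fin n → ℝ) 1, x ≠ 0 := by
    rintro x hx rfl; simp at hx
  have hys : ‖y‖⁻¹ • y ∈ Metric.sphere (0 : Fin n → ℝ) 1 := by
    simp [norm_smul, inv_mul_cancel₀ hne]
  -- Maximise the generalised Rayleigh quotient of `D` against `Z`. The maximum `τ` is positive, and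
  -- `τ Z - D ≥ 0` annihilates the maximiser, so `D v = τ Z v`. The Lyapunov form of `D` at `v` is
  -- then `τ` times that of `Z`, hence negative.
  obtain ⟨v, hv, hmax⟩ := (isCompact_sphere (0 : Fin n → ℝ) 1).exists_isMaxOn ⟨_, hys⟩
    (f := fun x => (x ⬝ᵥ (D *ᵥ x)) / (x ⬝ᵥ (Z *ᵥ x)))
    ((continuous_dotProduct_mulVec D).continuousOn.div
      (continuous_dotProduct_mulVec Z).continuousOn fun x hx => (hZp x (hsph x hx)).ne')
  set τ : ℝ := (v ⬝ᵥ (D *ᵥ v)) / (v ⬝ᵥ (Z *ᵥ v)) with hτ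
  have hv0 := hsph v hv
  have hle : ∀ x, x ⬝ᵥ (D *ᵥ x) ≤ τ * (x ⬝ᵥ (Z *ᵥ x)) := by
    intro x
    by_cases hx : x = 0
    · simp [hx]
    have hn : ‖x‖ ≠ 0 := norm_ne_zero_iff.2 hx
    have h1 := hmax (show ‖x‖⁻¹ • x ∈ Metric.sphere (0 : Fin n → ℝ) 1 by
      simp [norm_smul, inv_mul_cancel₀ hn])
    simp only [Set.mem_ofPred_eq, smul_dotProduct_mulVec_smul] at h1
    rw [mul_div_mul_left _ _ (pow_ne_zero 2 (inv_ne_zero hn)), div_le_iff₀ (hZp x hx)] at h1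
    exact h1
  have hτ0 : 0 < τ := by
    by_contra! h
    have := hle y
    have h2 := mul_nonpos_of_nonpos_of_nonneg h (hZp y hy0).le
    linarith
  have hE : (τ • Z - D).PosSemidef := by
    rw [posSemidef_iff_real]
    refine ⟨by rw [Matrix.transpose_sub, Matrix.transpose_smul, hZs, hD], fun x => ?_⟩
    rw [Matrix.sub_mulVec, dotProduct_sub, Matrix.smul_mulVec, dotProduct_smul, smul_eq_mul]
    linarith [hle x]
  have hEv : (τ • Z - D) *ᵥ v = 0 := by
    apply hE.mulVec_eq_zero_of_le
    rw [Matrix.sub_mulVec, dotProduct_sub, Matrix.smul_mulVec, dotProduct_smul, smul_eq_mul, hτ,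
      div_mul_cancel₀ _ (hZp v hv0).ne', sub_self]
  have hDv : D *ᵥ v = τ • (Z *ᵥ v) := by
    rw [Matrix.sub_mulVec, sub_eq_zero, Matrix.smul_mulVec] at hEv
    exact hEv.symm
  have h1 := hDF v
  have h2 := hF v hv0
  rw [dotProduct_lyapunov hD, hDv, smul_dotProduct, smul_eq_mul] at h1
  rw [dotProduct_lyapunov hZs] at h2
  nlinarith

/-! ### The Riccati operator, and the Hautus test for semidefinite matrices. -/

/-- The left-hand side of the algebraic Riccati equation, with `S` in the place of `B R⁻¹ Bᵀ`. -/
def riccati {n : ℕ} (A S Q P : Matrix (Fin n) (Fin n) ℝ) : Matrix (Fin n) (Fin n) ℝ :=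
  P * A + Aᵀ * P - P * S * P + Q

theorem riccati_transpose {n : ℕ} {A S Q P : Matrix (Fin n) (Fin n) ℝ} (hS : Sᵀ = S) (hQ : Qᵀ = Q)
    (hP : Pᵀ = P) : (riccati A S Q P)ᵀ = riccati A S Q P := by
  simp only [riccati, Matrix.transpose_add, Matrix.transpose_sub, Matrix.transpose_mul,
    Matrix.transpose_transpose, hS, hQ, hP, Matrix.mul_assoc]
  abel

theorem dotProduct_riccati {n : ℕ} {A S Q P : Matrix (Fin n) (Fin n) ℝ} (hP : Pᵀ = P)
    (x : Fin n → ℝ) : x ⬝ᵥ (riccati A S Q P *ᵥ x) =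
      x ⬝ᵥ ((P * A + Aᵀ * P) *ᵥ x) - (P *ᵥ x) ⬝ᵥ (S *ᵥ (P *ᵥ x)) + x ⬝ᵥ (Q *ᵥ x) := by
  rw [riccati, Matrix.add_mulVec, Matrix.sub_mulVec, dotProduct_add, dotProduct_sub]
  congr 2
  rw [← Matrix.mulVec_mulVec, ← Matrix.mulVec_mulVec]
  nth_rw 1 [← hP]
  rw [dotProduct_transpose_mulVec, dotProduct_comm]

/-- Expansion of the Riccati operator around a symmetric `P`. -/
theorem riccati_add {n : ℕ} (A S Q P D : Matrix (Fin n) (Fin n) ℝ) (hS : Sᵀ = S) (hP : Pᵀ = P) :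
    riccati A S Q (P + D) =
      riccati A S Q P + (D * (A - S * P) + (A - S * P)ᵀ * D) - D * S * D := by
  simp only [riccati, Matrix.transpose_sub, Matrix.transpose_mul, hS, hP]
  noncomm_ring

/-- Invariance of the real range passes to the complexified range by splitting into real and
imaginary parts; a nonzero invariant complex subspace contains an eigenvector. -/
theorem exists_eigenvector_mem_range {n : ℕ} (X M : Matrix (Fin n) (Fin n) ℝ) (hX : X ≠ 0)
    (hM : ∀ z, ∃ w, M *ᵥ (X *ᵥ z) = X *ᵥ w) :
    ∃ (μ : ℂ) (z : Fin n → ℂ), X.map (algebraMap ℝ ℂ) *ᵥ z ≠ 0 ∧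
      M.map (algebraMap ℝ ℂ) *ᵥ (X.map (algebraMap ℝ ℂ) *ᵥ z) =
        μ • (X.map (algebraMap ℝ ℂ) *ᵥ z) := by
  set Xc := X.map (algebraMap ℝ ℂ) with hXc
  set Mc := M.map (algebraMap ℝ ℂ) with hMc
  let V : Submodule ℂ (Fin n → ℂ) := LinearMap.range (Matrix.toLin' Xc)
  have hinv : ∀ v ∈ V, Matrix.toLin' Mc v ∈ V := by
    rintro _ ⟨z, rfl⟩
    obtain ⟨w1, h1⟩ := hM fun j => (z j).re
    obtain ⟨w2, h2⟩ := hM fun j => (z j).im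
    refine ⟨fun j => ⟨w1 j, w2 j⟩, ?_⟩
    simp only [Matrix.toLin'_apply]
    ext i
    apply Complex.ext
    · rw [congrFun (re_map_mulVec X _) i, congrFun (re_map_mulVec M _) i, re_map_mulVec X, h1]
    · rw [congrFun (im_map_mulVec X _) i, congrFun (im_map_mulVec M _) i, im_map_mulVec X, h2]
  have hXc0 : Xc ≠ 0 := by
    intro h
    apply hX
    ext i j
    simpa [hXc] using congrFun (congrFun h i) j
  have hV : V ≠ ⊥ := by
    intro h
    rw [LinearMap.range_eq_bot] at h
    exact hXc0 (by simpa using h)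
  have : Nontrivial V := Submodule.nontrivial_iff_ne_bot.2 hV
  obtain ⟨μ, hμ⟩ := Module.End.exists_eigenvalue ((Matrix.toLin' Mc).restrict hinv)
  obtain ⟨⟨v, z, rfl⟩, hv⟩ := hμ.exists_hasEigenvector
  refine ⟨μ, z, ?_, ?_⟩
  · intro h
    apply hv.2
    ext1
    simpa using h
  · have := congrArg Subtype.val hv.apply_eq_smul
    simpa using this

theorem re_im_of_eigenvector {n : ℕ} {M : Matrix (Fin n) (Fin n) ℝ} {μ : ℂ} {z : Fin n → ℂ}
    (h : M.map (algebraMap ℝ ℂ) *ᵥ z = μ • z) :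
    (M *ᵥ fun j => (z j).re) = μ.re • (fun j => (z j).re) - μ.im • (fun j => (z j).im) ∧
    (M *ᵥ fun j => (z j).im) = μ.im • (fun j => (z j).re) + μ.re • (fun j => (z j).im) := by
  rw [← re_map_mulVec, ← im_map_mulVec, h]
  constructor
  · ext i; simp
  · ext i; simp; ring

theorem mem_range_mulVec_of_symm {n : ℕ} {X : Matrix (Fin n) (Fin n) ℝ} (hX : Xᵀ = X)
    {y : Fin n → ℝ} (hy : ∀ v, X *ᵥ v = 0 → y ⬝ᵥ v = 0) : ∃ w, y = X *ᵥ w := by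
  by_contra hcon
  have hmem : y ∉ LinearMap.range (Matrix.toLin' X) := by
    rintro ⟨w, hw⟩
    exact hcon ⟨w, by simpa using hw.symm⟩
  obtain ⟨f, hf0, hf⟩ := Submodule.exists_le_ker_of_notMem hmem
  set v : Fin n → ℝ := fun i => f (Pi.single i 1) with hv
  have hfv : ∀ x, f x = v ⬝ᵥ x := by
    intro x
    rw [LinearMap.pi_apply_eq_sum_univ f x]
    simp only [dotProduct, hv, smul_eq_mul]
    refine Finset.sum_congr rfl fun i _ => ?_
    rw [mul_comm]
    congr 2
    ext j
    simp [Pi.single_apply, eq_comm]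
  apply hf0
  rw [hfv, dotProduct_comm]
  apply hy
  have h1 : ∀ x, x ⬝ᵥ (X *ᵥ v) = 0 := by
    intro x
    rw [← hX, dotProduct_transpose_mulVec, ← hfv]
    exact LinearMap.mem_ker.1 (hf ⟨x, by simp⟩)
  exact dotProduct_self_eq_zero.1 (h1 _)

/-- A positive semidefinite `X` supported on the kernel of `Bᵀ` with `X A + Aᵀ X ≥ 0` vanishes. -/
theorem HautusTest.eq_zero_of_posSemidef {n m : ℕ} {A : Matrix (Fin n) (Fin n) ℝ}
    {B : Matrix (Fin n) (Fin m) ℝ} (h : HautusTest A B) {X : Matrix (Fin n) (Fin n) ℝ}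
    (hX : X.PosSemidef) (hB : ∀ x, Bᵀ *ᵥ (X *ᵥ x) = 0)
    (hA : ∀ x, 0 ≤ x ⬝ᵥ ((X * A + Aᵀ * X) *ᵥ x)) : X = 0 := by
  by_contra hX0
  have hXs := (posSemidef_iff_real.1 hX).1
  have hL : (X * A + Aᵀ * X).PosSemidef := by
    rw [posSemidef_iff_real]
    refine ⟨?_, hA⟩
    rw [Matrix.transpose_add, Matrix.transpose_mul, Matrix.transpose_mul, hXs,
      Matrix.transpose_transpose, add_comm]
  -- The kernel of `X` is `A`-invariant: the nonnegative Lyapunov form vanishes there, so its matrix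
  -- does too. As `X` is symmetric, its range is then `Aᵀ`-invariant and contains an eigenvector.
  have hker : ∀ v, X *ᵥ v = 0 → X *ᵥ (A *ᵥ v) = 0 := by
    intro v hv
    have h1 : (X * A + Aᵀ * X) *ᵥ v = 0 := by
      apply hL.mulVec_eq_zero_of_le
      rw [dotProduct_lyapunov hXs, hv]
      simp
    rw [Matrix.add_mulVec, ← Matrix.mulVec_mulVec, ← Matrix.mulVec_mulVec, hv] at h1
    simpa using h1
  obtain ⟨μ, z, hz0, hz⟩ := exists_eigenvector_mem_range X Aᵀ hX0 fun z => by
    apply mem_range_mulVec_of_symm hXs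
    intro v hv
    rw [dotProduct_comm, dotProduct_transpose_mulVec, dotProduct_comm,
      ← dotProduct_transpose_mulVec, hXs, hker v hv, dotProduct_zero]
  refine hz0 (h μ _ ?_ hz ?_)
  -- Adding the inequalities for the real and imaginary parts cancels the `μ.im` terms and leaves `0
  -- ≤ 2 μ.re (aᵀ X a + bᵀ X b)`. A negative `μ.re` would force `X z = 0`.
  · obtain ⟨h1, h2⟩ := re_im_of_eigenvector hz
    rw [re_map_mulVec, im_map_mulVec] at h1 h2
    set a : Fin n → ℝ := fun j => (z j).re
    set b : Fin n → ℝ := fun j => (z j).im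
    have ha := hA a
    have hb := hA b
    rw [dotProduct_lyapunov hXs, ← dotProduct_transpose_mulVec, h1] at ha
    rw [dotProduct_lyapunov hXs, ← dotProduct_transpose_mulVec, h2] at hb
    simp only [dotProduct_sub, dotProduct_add, dotProduct_smul, smul_eq_mul] at ha hb
    have hab : b ⬝ᵥ (X *ᵥ a) = a ⬝ᵥ (X *ᵥ b) := by
      rw [← dotProduct_transpose_mulVec, hXs]
    have hpa := (posSemidef_iff_real.1 hX).2 a
    have hpb := (posSemidef_iff_real.1 hX).2 b
    by_contra! hneg
    have hsum : a ⬝ᵥ (X *ᵥ a) + b ⬝ᵥ (X *ᵥ b) ≤ 0 := by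
      by_contra! hpos
      rw [hab] at hb
      nlinarith
    have hXa := hX.mulVec_eq_zero_of_le (x := a) (by linarith)
    have hXb := hX.mulVec_eq_zero_of_le (x := b) (by linarith)
    apply hz0
    ext i
    apply Complex.ext
    · rw [congrFun (re_map_mulVec X z) i]; exact congrFun hXa i
    · rw [congrFun (im_map_mulVec X z) i]; exact congrFun hXb i
  · ext i
    apply Complex.ext
    · rw [congrFun (re_map_mulVec Bᵀ _) i, re_map_mulVec, hB]; rfl
    · rw [congrFun (im_map_mulVec Bᵀ _) i, im_map_mulVec, hB]; rfl

/-! ### Existence of a positive semidefinite Riccati solution. -/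

section RiccatiExistence

open scoped Matrix.Norms.Operator

variable {n m : ℕ} {A S Q : Matrix (Fin n) (Fin n) ℝ} {B : Matrix (Fin n) (Fin m) ℝ}

theorem isClosed_posSemidef : IsClosed {P : Matrix (Fin n) (Fin n) ℝ | P.PosSemidef} := by
  simp_rw [posSemidef_iff_real, Set.ofPred_and, Set.ofPred_forall]
  refine (isClosed_eq (by fun_prop) continuous_id).inter (isClosed_iInter fun x => ?_)
  exact isClosed_le continuous_const (by fun_prop)

theorem continuous_riccati : Continuous (riccati A S Q) := by
  unfold riccati
  fun_prop

/-- The term `P S P` is quadratic and the others grow at most linearly. Along normalised `Y = P /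
‖P‖` with `‖P‖ → ∞`, the subsolution inequality thus gives in the limit both `S X = 0` and `X A + Aᵀ
X ≥ 0`. The Hautus test then gives `X = 0`, against `‖X‖ = 1`. -/
theorem isBounded_riccati_subsolutions (h : HautusTest A B) (hS : S.PosSemidef)
    (hSB : ∀ y, S *ᵥ y = 0 → Bᵀ *ᵥ y = 0) :
    Bornology.IsBounded {P : Matrix (Fin n) (Fin n) ℝ | P.PosSemidef ∧
      (riccati A S Q P).PosSemidef} := by
  by_contra hcon
  have hex : ∀ k : ℕ, ∃ P : Matrix (Fin n) (Fin n) ℝ, (P.PosSemidef ∧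
      (riccati A S Q P).PosSemidef) ∧ (k : ℝ) < ‖P‖ := by
    intro k
    by_contra! hk
    exact hcon (isBounded_iff_forall_norm_le.2 ⟨k, fun P hP => hk P hP⟩)
  choose P hP hk using hex
  have hpos : ∀ k, 0 < ‖P k‖ := fun k => (Nat.cast_nonneg k).trans_lt (hk k)
  have hmem : ∀ k, ‖P k‖⁻¹ • P k ∈ Metric.sphere (0 : Matrix (Fin n) (Fin n) ℝ) 1 := by
    intro k
    rw [mem_sphere_zero_iff_norm, norm_smul, norm_inv, norm_norm, inv_mul_cancel₀ (hpos k).ne']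
  have : ProperSpace (Matrix (Fin n) (Fin n) ℝ) := FiniteDimensional.proper ℝ _
  obtain ⟨X, hX, φ, hφ, hlim⟩ :=
    (isCompact_sphere (0 : Matrix (Fin n) (Fin n) ℝ) 1).tendsto_subseq hmem
  have hinv : Tendsto (fun k => ‖P (φ k)‖⁻¹) atTop (𝓝 0) :=
    (tendsto_atTop_mono (fun k => (hk k).le) tendsto_natCast_atTop_atTop).inv_tendsto_atTop.comp
      hφ.tendsto_atTop
  have hXpsd : X.PosSemidef := isClosed_posSemidef.mem_of_tendsto hlim
    (Eventually.of_forall fun k => (hP (φ k)).1.smul (inv_nonneg.2 (hpos _).le))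
  set Y : ℕ → Matrix (Fin n) (Fin n) ℝ := fun k => ‖P (φ k)‖⁻¹ • P (φ k) with hY
  have hlim' : Tendsto Y atTop (𝓝 X) := hlim
  have hineq : ∀ k x, ‖P (φ k)‖ * ((Y k *ᵥ x) ⬝ᵥ (S *ᵥ (Y k *ᵥ x))) ≤
      x ⬝ᵥ ((Y k * A + Aᵀ * Y k) *ᵥ x) + ‖P (φ k)‖⁻¹ * (x ⬝ᵥ (Q *ᵥ x)) := by
    intro k x
    have h1 := (posSemidef_iff_real.1 (hP (φ k)).2).2 x
    rw [dotProduct_riccati (posSemidef_iff_real.1 (hP (φ k)).1).1] at h1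
    have hp := hpos (φ k)
    have h2 : x ⬝ᵥ ((Y k * A + Aᵀ * Y k) *ᵥ x) =
        ‖P (φ k)‖⁻¹ * (x ⬝ᵥ ((P (φ k) * A + Aᵀ * P (φ k)) *ᵥ x)) := by
      rw [hY, Matrix.smul_mul, Matrix.mul_smul, ← smul_add, Matrix.smul_mulVec, dotProduct_smul,
        smul_eq_mul]
    have h3 : Y k *ᵥ x = ‖P (φ k)‖⁻¹ • (P (φ k) *ᵥ x) := by rw [hY, Matrix.smul_mulVec]
    rw [h2, h3, smul_dotProduct_mulVec_smul, ← mul_add]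
    have h4 : ‖P (φ k)‖ * (‖P (φ k)‖⁻¹ ^ 2 * ((P (φ k) *ᵥ x) ⬝ᵥ (S *ᵥ (P (φ k) *ᵥ x)))) =
        ‖P (φ k)‖⁻¹ * ((P (φ k) *ᵥ x) ⬝ᵥ (S *ᵥ (P (φ k) *ᵥ x))) := by
      field_simp
    rw [h4]
    exact mul_le_mul_of_nonneg_left (by linarith) (inv_nonneg.2 hp.le)
  have hS0 : ∀ k x, 0 ≤ (Y k *ᵥ x) ⬝ᵥ (S *ᵥ (Y k *ᵥ x)) := fun k x =>
    (posSemidef_iff_real.1 hS).2 _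
  have hL : ∀ x, Tendsto (fun k => x ⬝ᵥ ((Y k * A + Aᵀ * Y k) *ᵥ x) +
      ‖P (φ k)‖⁻¹ * (x ⬝ᵥ (Q *ᵥ x))) atTop (𝓝 (x ⬝ᵥ ((X * A + Aᵀ * X) *ᵥ x))) := by
    intro x
    have hc : Continuous fun Z : Matrix (Fin n) (Fin n) ℝ => x ⬝ᵥ ((Z * A + Aᵀ * Z) *ᵥ x) := by
      fun_prop
    simpa using ((hc.tendsto X).comp hlim').add (hinv.mul_const (x ⬝ᵥ (Q *ᵥ x)))
  have hX0 : X = 0 := by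
    refine h.eq_zero_of_posSemidef hXpsd (fun x => hSB _ (hS.mulVec_eq_zero_of_le ?_)) fun x => ?_
    · have hc : Continuous fun Z : Matrix (Fin n) (Fin n) ℝ => (Z *ᵥ x) ⬝ᵥ (S *ᵥ (Z *ᵥ x)) := by
        fun_prop
      have h0 := hinv.mul (hL x)
      rw [zero_mul] at h0
      refine le_of_tendsto_of_tendsto' ((hc.tendsto X).comp hlim') h0 fun k => ?_
      rw [inv_mul_eq_div, le_div_iff₀ (hpos _), mul_comm]
      exact hineq k x
    · exact ge_of_tendsto' (hL x) fun k =>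
        (mul_nonneg (hpos _).le (hS0 k x)).trans (hineq k x)
  simp [hX0] at hX

theorem abs_dotProduct_mulVec_le (M : Matrix (Fin n) (Fin n) ℝ) (x : Fin n → ℝ) :
    |x ⬝ᵥ (M *ᵥ x)| ≤ n * ‖M‖ * (x ⬝ᵥ x) := by
  have hx : ‖x‖ ^ 2 ≤ x ⬝ᵥ x := by
    have h0 : 0 ≤ x ⬝ᵥ x := Finset.sum_nonneg fun i _ => mul_self_nonneg _
    have : ‖x‖ ≤ √(x ⬝ᵥ x) := by
      refine (pi_norm_le_iff_of_nonneg (Real.sqrt_nonneg _)).2 fun i => ?_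
      refine Real.abs_le_sqrt ?_
      rw [sq]
      exact Finset.single_le_sum (f := fun i => x i * x i) (fun j _ => mul_self_nonneg _)
        (Finset.mem_univ i)
    calc ‖x‖ ^ 2 ≤ √(x ⬝ᵥ x) ^ 2 := by gcongr
      _ = _ := Real.sq_sqrt h0
  have hM : ‖M *ᵥ x‖ ≤ ‖M‖ * ‖x‖ := Matrix.linfty_opNorm_mulVec M x
  calc |x ⬝ᵥ (M *ᵥ x)| ≤ ∑ i, |x i * (M *ᵥ x) i| := Finset.abs_sum_le_sum_abs _ _
    _ ≤ ∑ _i : Fin n, ‖x‖ * (‖M‖ * ‖x‖) := by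
      refine Finset.sum_le_sum fun i _ => ?_
      rw [abs_mul]
      exact mul_le_mul (norm_le_pi_norm x i) ((norm_le_pi_norm _ i).trans hM) (abs_nonneg _)
        (norm_nonneg _)
    _ = n * ‖M‖ * ‖x‖ ^ 2 := by simp; ring
    _ ≤ _ := by gcongr

/-- One implicit Euler step of the Riccati flow. -/
theorem exists_riccati_implicit_step (hS : Sᵀ = S) (hQ : Qᵀ = Q) {P : Matrix (Fin n) (Fin n) ℝ}
    (hP : Pᵀ = P) (hW : (riccati A S Q P).PosSemidef) :
    ∃ h > (0 : ℝ), ∃ D : Matrix (Fin n) (Fin n) ℝ, D.PosSemidef ∧ D = h • riccati A S Q (P + D) := by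
  -- Symmetrising inside `Φ` lets the inverse function argument run on all matrices: values of `Φ`
  -- are symmetric, so any solution of `D = h Φ D` is symmetric too.
  let symm : Matrix (Fin n) (Fin n) ℝ → Matrix (Fin n) (Fin n) ℝ := fun D => (1 / 2 : ℝ) • (D + Dᵀ)
  let Φ : Matrix (Fin n) (Fin n) ℝ → Matrix (Fin n) (Fin n) ℝ := fun D => riccati A S Q (P + symm D)
  have htr : ContDiff ℝ 1 (fun D : Matrix (Fin n) (Fin n) ℝ => Dᵀ) :=
    (LinearMap.toContinuousLinearMap
      (Matrix.transposeLinearEquiv (Fin n) (Fin n) ℝ ℝ).toLinearMap).contDiff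
  have hΦ : ContDiff ℝ 1 Φ := by
    have h1 : ContDiff ℝ 1 symm := (contDiff_id.add htr).const_smul _
    have h2 : ContDiff ℝ 1 fun D : Matrix (Fin n) (Fin n) ℝ => P + symm D := contDiff_const.add h1
    exact (((h2.mul contDiff_const).add (contDiff_const.mul h2)).sub
      ((h2.mul contDiff_const).mul h2)).add contDiff_const
  have hΦsymm : ∀ D, (Φ D)ᵀ = Φ D := by
    intro D
    apply riccati_transpose hS hQ
    simp only [symm, Matrix.transpose_add, Matrix.transpose_smul, Matrix.transpose_transpose, hP]
    rw [add_comm Dᵀ]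
  -- The derivative of `Ψ` at the origin is onto, so images of neighbourhoods are neighbourhoods.
  -- For small `h > 0` the point `(0, h)` is therefore attained with a small `D`.
  let Ψ : Matrix (Fin n) (Fin n) ℝ × ℝ → Matrix (Fin n) (Fin n) ℝ × ℝ := fun p => (p.1 - p.2 • Φ p.1, p.2)
  have hΦ' := (hΦ.contDiffAt (x := 0)).hasStrictFDerivAt one_ne_zero
  have hd : HasStrictFDerivAt Ψ (((ContinuousLinearMap.fst ℝ (Matrix (Fin n) (Fin n) ℝ) ℝ) -
      ((0 : ℝ) • ((fderiv ℝ Φ 0).comp (ContinuousLinearMap.fst ℝ (Matrix (Fin n) (Fin n) ℝ) ℝ)) +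
        (ContinuousLinearMap.snd ℝ (Matrix (Fin n) (Fin n) ℝ) ℝ).smulRight (Φ 0))).prod (ContinuousLinearMap.snd ℝ (Matrix (Fin n) (Fin n) ℝ) ℝ))
      (0, 0) := by
    refine HasStrictFDerivAt.prodMk (hasStrictFDerivAt_fst.sub ?_) hasStrictFDerivAt_snd
    exact (hasStrictFDerivAt_snd (p := ((0 : Matrix (Fin n) (Fin n) ℝ), (0 : ℝ)))).smul
      (HasStrictFDerivAt.comp (g := Φ) (f := Prod.fst) ((0 : Matrix (Fin n) (Fin n) ℝ), (0 : ℝ)) hΦ'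
        hasStrictFDerivAt_fst)
  have hsurj := hd.map_nhds_eq_of_surj (by
    rw [LinearMap.range_eq_top]
    rintro ⟨D, h⟩
    exact ⟨(D + h • Φ 0, h), by simp⟩)
  have hΨ0 : Ψ (0, 0) = (0, 0) := by simp [Ψ]
  have hcont : Continuous fun p : Matrix (Fin n) (Fin n) ℝ × ℝ =>
      n * ‖p.2 • ((A - S * P) - (1 / 2 : ℝ) • (S * p.1))‖ := by fun_prop
  have hU : {p : Matrix (Fin n) (Fin n) ℝ × ℝ | n * ‖p.2 • ((A - S * P) - (1 / 2 : ℝ) • (S * p.1))‖ < 1 / 2} ∈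
      𝓝 ((0 : Matrix (Fin n) (Fin n) ℝ), (0 : ℝ)) := by
    refine (isOpen_lt hcont continuous_const).mem_nhds ?_
    simp
  have him := Filter.image_mem_map (m := Ψ) hU
  have hΨm : Filter.map Ψ (𝓝 ((0 : Matrix (Fin n) (Fin n) ℝ), (0 : ℝ))) = 𝓝 (0, 0) :=
    hsurj.trans (congrArg 𝓝 hΨ0)
  rw [hΨm] at him
  have hev : ∀ᶠ h : ℝ in 𝓝[>] 0, ((0 : Matrix (Fin n) (Fin n) ℝ), h) ∈ Ψ ''
      {p : Matrix (Fin n) (Fin n) ℝ × ℝ | n * ‖p.2 • ((A - S * P) - (1 / 2 : ℝ) • (S * p.1))‖ < 1 / 2} := by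
    refine ((Continuous.tendsto (f := fun h : ℝ => ((0 : Matrix (Fin n) (Fin n) ℝ), h)) (by fun_prop) 0).mono_left
      nhdsWithin_le_nhds) him
  obtain ⟨h, ⟨⟨D, h'⟩, hD, hΨ⟩, hh⟩ := (hev.and self_mem_nhdsWithin).exists
  simp only [Ψ, Prod.mk.injEq] at hΨ
  obtain ⟨hD1, rfl⟩ := hΨ
  rw [sub_eq_zero] at hD1
  have hDs : Dᵀ = D := by rw [hD1, Matrix.transpose_smul, hΦsymm]
  have hsym : symm D = D := by
    simp only [symm, hDs, ← two_smul ℝ D, smul_smul]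
    norm_num
  have hΦD : Φ D = riccati A S Q (P + D) := by simp only [Φ, hsym]
  rw [hΦD] at hD1
  have hh0 : 0 < h' := hh
  refine ⟨h', hh0, D, ?_, hD1⟩
  -- Both `D` and `D S D` are split equally between the two sides, turning the step equation into `D
  -- F + Fᵀ D = -h' riccati P`. By the bound `1 / 2` in `hU`, the term `-1/2 • 1` dominates, so the
  -- identity is a strict Lyapunov matrix for `F`; comparison applied to `-D` gives `D ≥ 0`.
  set F : Matrix (Fin n) (Fin n) ℝ := h' • ((A - S * P) - (1 / 2 : ℝ) • (S * D)) - (1 / 2 : ℝ) • 1 with hF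
  have hlyap : D * F + Fᵀ * D = -(h' • riccati A S Q P) := by
    have h1 := hD1
    rw [riccati_add A S Q P D hS hP] at h1
    have h2 : D * F + Fᵀ * D = h' • (riccati A S Q P + (D * (A - S * P) + (A - S * P)ᵀ * D) -
        D * S * D) - D - h' • riccati A S Q P := by
      simp only [hF, Matrix.transpose_sub, Matrix.transpose_smul, Matrix.transpose_mul, hS, hDs,
        Matrix.transpose_one, Matrix.mul_sub, Matrix.sub_mul, Matrix.mul_smul, Matrix.smul_mul,
        Matrix.mul_one, Matrix.one_mul, Matrix.mul_assoc, hP]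
      module
    rw [h2, ← h1]
    simp
  have := posSemidef_neg_of_lyapunov (Z := 1) (F := F) (D := -D) Matrix.PosDef.one ?_
    (by rw [Matrix.transpose_neg, hDs]) ?_
  · simpa using this
  · intro x hx
    rw [dotProduct_lyapunov Matrix.transpose_one, Matrix.one_mulVec, hF, Matrix.sub_mulVec,
      dotProduct_sub, Matrix.smul_mulVec (1 / 2 : ℝ), Matrix.one_mulVec, dotProduct_smul,
      smul_eq_mul]
    have hxx : 0 < x ⬝ᵥ x := by
      have := dotProduct_self_eq_zero (v := x)
      exact lt_of_le_of_ne (Finset.sum_nonneg fun i _ => mul_self_nonneg (x i)) fun h => hx (this.1 h.symm)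
    have h1 := (abs_le.1 (abs_dotProduct_mulVec_le
      (h' • ((A - S * P) - (1 / 2 : ℝ) • (S * D))) x)).2
    have h2 := mul_lt_mul_of_pos_right hD hxx
    simp only at h2
    linarith
  · intro x
    have hWx := (posSemidef_iff_real.1 hW).2 x
    rw [Matrix.neg_mul, Matrix.mul_neg, ← neg_add, hlyap, neg_neg, Matrix.smul_mulVec,
      dotProduct_smul, smul_eq_mul]
    positivity

/-- At a trace maximiser among subsolutions, the implicit step reaches `P + D` with residual `t⁻¹ D
≥ 0`, again a subsolution. Maximality gives trace `D = 0`, hence `D = 0`, and the residual at `P` is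
zero. -/
theorem exists_posSemidef_riccati_eq_zero (h : HautusTest A B) (hS : S.PosSemidef)
    (hSB : ∀ y, S *ᵥ y = 0 → Bᵀ *ᵥ y = 0) (hQ : Q.PosSemidef) :
    ∃ P : Matrix (Fin n) (Fin n) ℝ, P.PosSemidef ∧ riccati A S Q P = 0 := by
  have : ProperSpace (Matrix (Fin n) (Fin n) ℝ) := FiniteDimensional.proper ℝ _
  have hcpt : IsCompact {P : Matrix (Fin n) (Fin n) ℝ | P.PosSemidef ∧
      (riccati A S Q P).PosSemidef} :=
    Metric.isCompact_of_isClosed_isBounded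
      (isClosed_posSemidef.inter (isClosed_posSemidef.preimage continuous_riccati))
      (isBounded_riccati_subsolutions h hS hSB)
  obtain ⟨P, ⟨hP, hW⟩, hmax⟩ := hcpt.exists_isMaxOn
    ⟨0, Matrix.PosSemidef.zero, by simpa [riccati] using hQ⟩
    (f := Matrix.trace) (by fun_prop)
  refine ⟨P, hP, ?_⟩
  obtain ⟨t, ht, D, hD, hDe⟩ := exists_riccati_implicit_step (posSemidef_iff_real.1 hS).1
    (posSemidef_iff_real.1 hQ).1 (posSemidef_iff_real.1 hP).1 hW
  have hR : riccati A S Q (P + D) = t⁻¹ • D := by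
    conv_rhs => rw [hDe]
    rw [smul_smul, inv_mul_cancel₀ ht.ne', one_smul]
  have hle := hmax (show P + D ∈ _ from
    ⟨hP.add hD, by rw [hR]; exact hD.smul (inv_nonneg.2 ht.le)⟩)
  simp only [Set.mem_ofPred_eq, Matrix.trace_add] at hle
  have hD0 : D = 0 := hD.trace_eq_zero_iff.1 (le_antisymm (by linarith) hD.trace_nonneg)
  rw [hD0] at hR
  simpa using hR

end RiccatiExistence

/-! ### Closed-loop stability and uniqueness of the Riccati solution. -/

section Algebraic

variable {n m p : ℕ} {A S Q P : Matrix (Fin n) (Fin n) ℝ} {B : Matrix (Fin n) (Fin m) ℝ}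
  {R : Matrix (Fin m) (Fin m) ℝ}

theorem dotProduct_inputWeight (x : Fin n → ℝ) :
    x ⬝ᵥ ((B * R⁻¹ * Bᵀ) *ᵥ x) = (Bᵀ *ᵥ x) ⬝ᵥ (R⁻¹ *ᵥ (Bᵀ *ᵥ x)) := by
  rw [← Matrix.mulVec_mulVec, ← Matrix.mulVec_mulVec, ← dotProduct_transpose_mulVec B,
    dotProduct_comm]

theorem inputWeight_posSemidef (hR : R.PosDef) : (B * R⁻¹ * Bᵀ).PosSemidef := by
  have := hR.inv.posSemidef.mul_mul_conjTranspose_same B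
  rwa [Matrix.conjTranspose_eq_transpose_of_trivial] at this

theorem transpose_mulVec_eq_zero_of_inputWeight (hR : R.PosDef) {y : Fin n → ℝ}
    (hy : (B * R⁻¹ * Bᵀ) *ᵥ y = 0) : Bᵀ *ᵥ y = 0 := by
  by_contra hne
  have h1 := (posDef_iff_real.1 hR.inv).2 _ hne
  rw [← dotProduct_inputWeight, hy, dotProduct_zero] at h1
  exact lt_irrefl _ h1

theorem lyapunov_of_riccati (hS : Sᵀ = S) (hP : Pᵀ = P) (hric : riccati A S Q P = 0) :
    P * (A - S * P) + (A - S * P)ᵀ * P = -(Q + P * S * P) := by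
  have h : P * (A - S * P) + (A - S * P)ᵀ * P = riccati A S Q P - (Q + P * S * P) := by
    simp only [riccati, Matrix.transpose_sub, Matrix.transpose_mul, hS, hP]
    noncomm_ring
  rw [h, hric, zero_sub]

/-- The closed-loop matrix `A - S P` has no eigenvalue in the closed right half-plane. -/
theorem closedLoop_hautusTest (hdet : HautusTest Aᵀ Qᵀ) (hS : S.PosSemidef) (hQ : Q.PosSemidef)
    (hP : P.PosSemidef) (hric : riccati A S Q P = 0) :
    HautusTest (A - S * P)ᵀ (0 : Matrix (Fin n) (Fin 0) ℝ) := by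
  intro μ z hμ hz _
  rw [Matrix.transpose_transpose] at hz
  have hSs := (posSemidef_iff_real.1 hS).1
  have hPs := (posSemidef_iff_real.1 hP).1
  have hlyap : ∀ x, 2 * ((P *ᵥ x) ⬝ᵥ ((A - S * P) *ᵥ x)) =
      -(x ⬝ᵥ (Q *ᵥ x) + (P *ᵥ x) ⬝ᵥ (S *ᵥ (P *ᵥ x))) := by
    intro x
    rw [← dotProduct_lyapunov hPs, lyapunov_of_riccati hSs hPs hric, Matrix.neg_mulVec,
      dotProduct_neg, Matrix.add_mulVec, dotProduct_add]
    congr 2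
    rw [← Matrix.mulVec_mulVec, ← Matrix.mulVec_mulVec]
    nth_rw 1 [← hPs]
    rw [dotProduct_transpose_mulVec, dotProduct_comm]
  obtain ⟨h1, h2⟩ := re_im_of_eigenvector hz
  set a : Fin n → ℝ := fun j => (z j).re with ha
  set b : Fin n → ℝ := fun j => (z j).im with hb
  have la := hlyap a
  have lb := hlyap b
  rw [h1, dotProduct_sub, dotProduct_smul, dotProduct_smul, smul_eq_mul, smul_eq_mul] at la
  rw [h2, dotProduct_add, dotProduct_smul, dotProduct_smul, smul_eq_mul, smul_eq_mul] at lb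
  have hab : (P *ᵥ b) ⬝ᵥ a = (P *ᵥ a) ⬝ᵥ b := by
    rw [dotProduct_comm, ← dotProduct_transpose_mulVec, hPs, dotProduct_comm]
  have hpa := (posSemidef_iff_real.1 hP).2 a
  have hpb := (posSemidef_iff_real.1 hP).2 b
  rw [dotProduct_comm] at hpa hpb
  have hqa := (posSemidef_iff_real.1 hQ).2 a
  have hqb := (posSemidef_iff_real.1 hQ).2 b
  have hsa := (posSemidef_iff_real.1 hS).2 (P *ᵥ a)
  have hsb := (posSemidef_iff_real.1 hS).2 (P *ᵥ b)
  have hp1 := mul_nonneg hμ hpa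
  have hp2 := mul_nonneg hμ hpb
  rw [hab] at lb
  -- The sum of `la` and `lb` equates a nonnegative multiple of `μ.re` with minus a sum of
  -- nonnegative forms, so each form is zero. Then `A` and `A - S P` agree on `z` and `Q z = 0`,
  -- which detectability excludes.
  have hQa := hQ.mulVec_eq_zero_of_le (x := a) (by linarith)
  have hQb := hQ.mulVec_eq_zero_of_le (x := b) (by linarith)
  have hSa := hS.mulVec_eq_zero_of_le (x := P *ᵥ a) (by linarith)
  have hSb := hS.mulVec_eq_zero_of_le (x := P *ᵥ b) (by linarith)
  have hAF : ∀ x, S *ᵥ (P *ᵥ x) = 0 → A *ᵥ x = (A - S * P) *ᵥ x := by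
    intro x hx
    rw [Matrix.sub_mulVec, ← Matrix.mulVec_mulVec, hx, sub_zero]
  refine hdet μ z hμ ?_ ?_
  · rw [Matrix.transpose_transpose, ← hz]
    ext i
    apply Complex.ext
    · rw [congrFun (re_map_mulVec _ z) i, congrFun (re_map_mulVec _ z) i, hAF _ hSa]
    · rw [congrFun (im_map_mulVec _ z) i, congrFun (im_map_mulVec _ z) i, hAF _ hSb]
  · rw [Matrix.transpose_transpose]
    ext i
    apply Complex.ext
    · rw [congrFun (re_map_mulVec _ z) i]; exact congrFun hQa i
    · rw [congrFun (im_map_mulVec _ z) i]; exact congrFun hQb i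

open scoped Matrix.Norms.Operator in
/-- A strict quadratic Lyapunov function for a matrix without eigenvalues in the closed right
half-plane. -/
theorem exists_lyapunov {F : Matrix (Fin n) (Fin n) ℝ}
    (hF : HautusTest Fᵀ (0 : Matrix (Fin n) (Fin 0) ℝ)) :
    ∃ Z : Matrix (Fin n) (Fin n) ℝ, Z.PosDef ∧
      (∀ x, 2 * ((Z *ᵥ x) ⬝ᵥ (F *ᵥ x)) = -((Z *ᵥ x) ⬝ᵥ (Z *ᵥ x))) ∧
      ∃ c > 0, ∀ x, c * (x ⬝ᵥ (Z *ᵥ x)) ≤ (Z *ᵥ x) ⬝ᵥ (Z *ᵥ x) := by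
  -- With `S = 0`, `Q = 1` and no inputs, the Riccati equation is `Y Fᵀ + F Y = -1`. The Lyapunov
  -- matrix is `Z = Y⁻¹`, for which `Z F + Fᵀ Z = -Z²`.
  obtain ⟨Y, hY, hYr⟩ := exists_posSemidef_riccati_eq_zero (S := 0) (Q := 1) hF
    Matrix.PosSemidef.zero (fun y _ => by ext i; exact i.elim0) Matrix.PosSemidef.one
  have hYs := (posSemidef_iff_real.1 hY).1
  have hYr' : Y * Fᵀ + F * Y = -1 := by
    simp only [riccati, Matrix.transpose_transpose, Matrix.mul_zero, Matrix.zero_mul,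
      sub_zero] at hYr
    exact eq_neg_of_add_eq_zero_left hYr
  have hYd : Y.PosDef := by
    refine posDef_iff_real.2 ⟨hYs, fun x hx => ?_⟩
    by_contra! hle
    have h0 := hY.mulVec_eq_zero_of_le hle
    have h1 := dotProduct_lyapunov hYs Fᵀ x
    rw [Matrix.transpose_transpose, hYr', h0, zero_dotProduct, mul_zero, Matrix.neg_mulVec,
      Matrix.one_mulVec, dotProduct_neg, neg_eq_zero] at h1
    exact hx (dotProduct_self_eq_zero.1 h1)
  have hdet : IsUnit Y.det := (Matrix.isUnit_iff_isUnit_det _).1 hYd.isUnit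
  have hYZ : ∀ x, Y *ᵥ (Y⁻¹ *ᵥ x) = x := fun x => by
    rw [Matrix.mulVec_mulVec, Matrix.mul_nonsing_inv _ hdet, Matrix.one_mulVec]
  refine ⟨Y⁻¹, hYd.inv, fun x => ?_, 1 / (n * ‖Y‖ + 1), by positivity, fun x => ?_⟩
  · have h1 := dotProduct_lyapunov hYs Fᵀ (Y⁻¹ *ᵥ x)
    rw [Matrix.transpose_transpose, hYr', hYZ, dotProduct_transpose_mulVec, Matrix.neg_mulVec,
      Matrix.one_mulVec, dotProduct_neg] at h1
    exact h1.symm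
  · have h1 := (abs_le.1 (abs_dotProduct_mulVec_le Y (Y⁻¹ *ᵥ x))).2
    rw [hYZ, dotProduct_comm] at h1
    have h2 : 0 ≤ (Y⁻¹ *ᵥ x) ⬝ᵥ (Y⁻¹ *ᵥ x) := Finset.sum_nonneg fun i _ => mul_self_nonneg _
    rw [one_div_mul_eq_div, div_le_iff₀ (by positivity)]
    linarith

/-- For `D = P₂ - P₁` and the stable `F = A - S P₁`, the expansion of the Riccati operator reads `D
F + Fᵀ D = D S D ≥ 0`, so comparison gives `D ≤ 0`. Exchanging the solutions gives uniqueness. -/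
theorem riccati_sub_posSemidef (hdet : HautusTest Aᵀ Qᵀ) (hS : S.PosSemidef) (hQ : Q.PosSemidef)
    {P₁ P₂ : Matrix (Fin n) (Fin n) ℝ} (h₁ : P₁.PosSemidef) (hr₁ : riccati A S Q P₁ = 0)
    (h₂ : P₂.PosSemidef) (hr₂ : riccati A S Q P₂ = 0) : (-(P₂ - P₁)).PosSemidef := by
  obtain ⟨Z, hZ, hZF, -⟩ := exists_lyapunov (closedLoop_hautusTest hdet hS hQ h₁ hr₁)
  have hSs := (posSemidef_iff_real.1 hS).1
  have h₁s := (posSemidef_iff_real.1 h₁).1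
  have hDs : (P₂ - P₁)ᵀ = P₂ - P₁ := by
    rw [Matrix.transpose_sub, h₁s, (posSemidef_iff_real.1 h₂).1]
  refine posSemidef_neg_of_lyapunov hZ (F := A - S * P₁) (fun x hx => ?_) hDs fun x => ?_
  · rw [dotProduct_lyapunov (posDef_iff_real.1 hZ).1, hZF, neg_lt_zero]
    refine lt_of_le_of_ne (Finset.sum_nonneg fun i _ => mul_self_nonneg _) fun h => ?_
    have h1 := (posDef_iff_real.1 hZ).2 x hx
    rw [dotProduct_self_eq_zero.1 h.symm, dotProduct_zero] at h1
    exact lt_irrefl _ h1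
  · have h := riccati_add A S Q P₁ (P₂ - P₁) hSs h₁s
    rw [add_sub_cancel, hr₁, hr₂, zero_add] at h
    rw [(sub_eq_zero.1 h.symm), ← Matrix.mulVec_mulVec, ← Matrix.mulVec_mulVec]
    nth_rw 1 [← hDs]
    rw [dotProduct_transpose_mulVec, dotProduct_comm]
    exact (posSemidef_iff_real.1 hS).2 _

theorem existsUnique_riccati (hstab : HautusTest A B) (hdet : HautusTest Aᵀ Qᵀ)
    (hQ : Q.PosSemidef) (hR : R.PosDef) : ∃! P, IsPSDRiccatiSolution A B Q R P := by
  have hS := inputWeight_posSemidef (B := B) hR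
  have heq : ∀ P, P * A + Aᵀ * P - P * B * R⁻¹ * Bᵀ * P + Q =
      riccati A (B * R⁻¹ * Bᵀ) Q P := by
    intro P
    simp only [riccati, Matrix.mul_assoc]
  simp only [IsPSDRiccatiSolution, heq]
  obtain ⟨P, hP, hr⟩ := exists_posSemidef_riccati_eq_zero hstab hS
    (fun y hy => transpose_mulVec_eq_zero_of_inputWeight hR hy) hQ
  refine ⟨P, ⟨hP, hr⟩, fun P' ⟨hP', hr'⟩ => ?_⟩
  have h1 := riccati_sub_posSemidef hdet hS hQ hP hr hP' hr'
  have h2 := riccati_sub_posSemidef hdet hS hQ hP' hr' hP hr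
  have h3 : ∀ x, (-(P - P')) *ᵥ x = 0 := by
    intro x
    apply h2.mulVec_eq_zero_of_le
    have := (posSemidef_iff_real.1 h1).2 x
    rw [← neg_sub P P', Matrix.neg_mulVec, dotProduct_neg] at this
    linarith
  have h4 : -(P - P') = 0 := Matrix.ext_of_mulVec_single fun i => by rw [h3, Matrix.zero_mulVec]
  rw [neg_sub, sub_eq_zero] at h4
  exact h4

/-! ### The optimal steady state and its multiplier. -/

/-- Lagrange conditions for the optimal steady state. -/
theorem exists_lagrange (hstab : HautusTest A B) (hdet : HautusTest Aᵀ Qᵀ)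
    (hQ : Q.PosSemidef) (hR : R.PosDef) (C : Matrix (Fin n) (Fin p) ℝ) (d : Fin p → ℝ) :
    ∃ (y : Fin n → ℝ) (u : Fin m → ℝ) (l : Fin n → ℝ), A *ᵥ y + B *ᵥ u + C *ᵥ d = 0 ∧
      Q *ᵥ y = -(Aᵀ *ᵥ l) ∧ R *ᵥ u = -(Bᵀ *ᵥ l) := by
  set S := B * R⁻¹ * Bᵀ with hSdef
  have hS : S.PosSemidef := inputWeight_posSemidef hR
  -- The Lagrange system after eliminating `u = -R⁻¹ Bᵀ l`. It is square, so injectivity suffices.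
  -- On the kernel, pairing the equations gives `lᵀ S l + yᵀ Q y = 0`, and the Hautus tests at `μ =
  -- 0` finish.
  let L : ((Fin n → ℝ) × (Fin n → ℝ)) →ₗ[ℝ] ((Fin n → ℝ) × (Fin n → ℝ)) :=
    ((Matrix.toLin' A).comp (LinearMap.fst ℝ _ _) - (Matrix.toLin' S).comp
      (LinearMap.snd ℝ _ _)).prod
    ((Matrix.toLin' Q).comp (LinearMap.fst ℝ _ _) + (Matrix.toLin' Aᵀ).comp
      (LinearMap.snd ℝ _ _))
  have hL : ∀ y l, L (y, l) = (A *ᵥ y - S *ᵥ l, Q *ᵥ y + Aᵀ *ᵥ l) := fun y l => by simp [L]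
  have hinj : Function.Injective L := by
    rw [← LinearMap.ker_eq_bot, LinearMap.ker_eq_bot']
    rintro ⟨y, l⟩ h
    rw [hL, Prod.mk_eq_zero, sub_eq_zero] at h
    obtain ⟨h1, h2⟩ := h
    have h3 : l ⬝ᵥ (S *ᵥ l) + y ⬝ᵥ (Q *ᵥ y) = 0 := by
      rw [← h1, eq_neg_of_add_eq_zero_left h2, dotProduct_neg, dotProduct_transpose_mulVec,
        add_neg_cancel]
    have hq := (posSemidef_iff_real.1 hQ).2 y
    have hs := (posSemidef_iff_real.1 hS).2 l
    have hQy := hQ.mulVec_eq_zero_of_le (x := y) (by linarith)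
    have hSl := hS.mulVec_eq_zero_of_le (x := l) (by linarith)
    have hBl := transpose_mulVec_eq_zero_of_inputWeight hR hSl
    rw [hSl] at h1
    rw [hQy, zero_add] at h2
    have hy0 := hdet 0 (fun j => (y j : ℂ)) le_rfl
      (by rw [Matrix.transpose_transpose, map_mulVec_ofReal, h1]; ext; simp)
      (by rw [Matrix.transpose_transpose, map_mulVec_ofReal, hQy]; ext; simp)
    have hl0 := hstab 0 (fun j => (l j : ℂ)) le_rfl
      (by rw [map_mulVec_ofReal, h2]; ext; simp)
      (by rw [map_mulVec_ofReal, hBl]; ext; simp)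
    ext i
    · simpa using congrFun hy0 i
    · simpa using congrFun hl0 i
  obtain ⟨⟨y, l⟩, hyl⟩ := LinearMap.injective_iff_surjective.1 hinj (-(C *ᵥ d), 0)
  rw [hL, Prod.mk.injEq] at hyl
  have hRdet : IsUnit R.det := (Matrix.isUnit_iff_isUnit_det _).1 hR.isUnit
  refine ⟨y, -(R⁻¹ *ᵥ (Bᵀ *ᵥ l)), l, ?_, eq_neg_of_add_eq_zero_left hyl.2, ?_⟩
  · rw [Matrix.mulVec_neg, Matrix.mulVec_mulVec, Matrix.mulVec_mulVec, ← hSdef, ← sub_eq_add_neg, hyl.1, neg_add_cancel]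
  · rw [Matrix.mulVec_neg, Matrix.mulVec_mulVec, Matrix.mul_nonsing_inv _ hRdet,
      Matrix.one_mulVec]

/-- Expansion of the cost around a point satisfying the Lagrange conditions. -/
theorem cost_expand (hQ : Qᵀ = Q) (hR : Rᵀ = R) {y : Fin n → ℝ} {u : Fin m → ℝ} {l : Fin n → ℝ}
    (hy : Q *ᵥ y = -(Aᵀ *ᵥ l)) (hu : R *ᵥ u = -(Bᵀ *ᵥ l)) (e : Fin n → ℝ) (v : Fin m → ℝ) :
    cost Q R (y + e) (u + v) =
      cost Q R y u + cost Q R e v - l ⬝ᵥ (A *ᵥ e + B *ᵥ v) := by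
  have h1 : y ⬝ᵥ (Q *ᵥ e) = e ⬝ᵥ (Q *ᵥ y) := by rw [← dotProduct_transpose_mulVec, hQ]
  have h2 : u ⬝ᵥ (R *ᵥ v) = v ⬝ᵥ (R *ᵥ u) := by rw [← dotProduct_transpose_mulVec, hR]
  have h3 : e ⬝ᵥ (Q *ᵥ y) = -(l ⬝ᵥ (A *ᵥ e)) := by
    rw [hy, dotProduct_neg, dotProduct_transpose_mulVec]
  have h4 : v ⬝ᵥ (R *ᵥ u) = -(l ⬝ᵥ (B *ᵥ v)) := by
    rw [hu, dotProduct_neg, dotProduct_transpose_mulVec]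
  simp only [cost, Matrix.mulVec_add, dotProduct_add, add_dotProduct]
  rw [h1, h2, h3, h4]
  ring

theorem cost_nonneg (hQ : Q.PosSemidef) (hR : R.PosDef) (y : Fin n → ℝ) (u : Fin m → ℝ) :
    0 ≤ cost Q R y u := by
  have h1 := (posSemidef_iff_real.1 hQ).2 y
  have h2 := (posSemidef_iff_real.1 hR.posSemidef).2 u
  unfold cost
  positivity

/-- Feasible differences are annihilated by the multiplier term, so the excess cost is exactly the
cost of the difference. Its vanishing forces equal controls and a state difference in the kernels of
`A` and `Q`, zero by detectability. -/
theorem steadyState_unique_of_lagrange (hdet : HautusTest Aᵀ Qᵀ)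
    (hQ : Q.PosSemidef) (hR : R.PosDef) {C : Matrix (Fin n) (Fin p) ℝ} {d : Fin p → ℝ}
    {y : Fin n → ℝ} {u : Fin m → ℝ} {l : Fin n → ℝ} (h : A *ᵥ y + B *ᵥ u + C *ᵥ d = 0)
    (hy : Q *ᵥ y = -(Aᵀ *ᵥ l)) (hu : R *ᵥ u = -(Bᵀ *ᵥ l)) :
    IsOptimalSteadyState A B C d Q R y u ∧
      ∀ y' u', IsOptimalSteadyState A B C d Q R y' u' → y' = y ∧ u' = u := by
  have key : ∀ y' u', A *ᵥ y' + B *ᵥ u' + C *ᵥ d = 0 →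
      A *ᵥ (y' - y) + B *ᵥ (u' - u) = 0 ∧
      cost Q R y' u' = cost Q R y u + cost Q R (y' - y) (u' - u) := by
    intro y' u' h'
    have h0 : A *ᵥ (y' - y) + B *ᵥ (u' - u) = 0 := by
      rw [Matrix.mulVec_sub, Matrix.mulVec_sub]
      linear_combination h' - h
    refine ⟨h0, ?_⟩
    have := cost_expand (posSemidef_iff_real.1 hQ).1 (posDef_iff_real.1 hR).1 hy hu (y' - y)
      (u' - u)
    rwa [h0, dotProduct_zero, sub_zero, add_sub_cancel, add_sub_cancel] at this
  refine ⟨⟨h, fun y' u' h' => ?_⟩, fun y' u' ⟨h', hopt⟩ => ?_⟩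
  · rw [(key y' u' h').2]
    exact le_add_of_nonneg_right (cost_nonneg hQ hR _ _)
  · obtain ⟨h0, hc⟩ := key y' u' h'
    have hle := hopt y u h
    have h1 := (posSemidef_iff_real.1 hQ).2 (y' - y)
    have h2 := (posSemidef_iff_real.1 hR.posSemidef).2 (u' - u)
    rw [hc] at hle
    unfold cost at hle
    have hQ0 := hQ.mulVec_eq_zero_of_le (x := y' - y) (by linarith)
    have hu0 : u' - u = 0 := by
      by_contra hne
      have := (posDef_iff_real.1 hR).2 _ hne
      linarith
    rw [hu0, Matrix.mulVec_zero, add_zero] at h0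
    have hy0 := hdet 0 (fun j => ((y' - y) j : ℂ)) le_rfl
      (by rw [Matrix.transpose_transpose, map_mulVec_ofReal, h0]; ext; simp)
      (by rw [Matrix.transpose_transpose, map_mulVec_ofReal, hQ0]; ext; simp)
    refine ⟨?_, sub_eq_zero.1 hu0⟩
    rw [← sub_eq_zero]
    ext i
    simpa only [Pi.zero_apply, Complex.ofReal_eq_zero] using congrFun hy0 i

end Algebraic

/-! ### Calculus along piecewise smooth trajectories, and a dissipation lemma. -/

section Analysis

theorem hasDerivWithinAt_dotProduct {n : ℕ} {f g : ℝ → Fin n → ℝ} {f' g' : Fin n → ℝ} {s : Set ℝ}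
    {t : ℝ} (hf : HasDerivWithinAt f f' s t) (hg : HasDerivWithinAt g g' s t) :
    HasDerivWithinAt (fun τ => f τ ⬝ᵥ g τ) (f' ⬝ᵥ g t + f t ⬝ᵥ g') s t := by
  rw [hasDerivWithinAt_pi] at hf hg
  have := HasDerivWithinAt.fun_sum (u := Finset.univ) fun i _ => (hf i).mul (hg i)
  simpa only [dotProduct, Finset.sum_add_distrib, Pi.mul_apply] using this

theorem hasDerivWithinAt_mulVec {n k : ℕ} (M : Matrix (Fin k) (Fin n) ℝ) {f : ℝ → Fin n → ℝ}
    {f' : Fin n → ℝ} {s : Set ℝ} {t : ℝ} (hf : HasDerivWithinAt f f' s t) :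
    HasDerivWithinAt (fun τ => M *ᵥ f τ) (M *ᵥ f') s t :=
  (LinearMap.toContinuousLinearMap (Matrix.toLin' M)).hasFDerivAt.comp_hasDerivWithinAt t hf

theorem hasDerivWithinAt_quadratic {n : ℕ} {M : Matrix (Fin n) (Fin n) ℝ} (hM : Mᵀ = M)
    {f : ℝ → Fin n → ℝ} {f' : Fin n → ℝ} {s : Set ℝ} {t : ℝ} (hf : HasDerivWithinAt f f' s t) :
    HasDerivWithinAt (fun τ => f τ ⬝ᵥ (M *ᵥ f τ)) (2 * ((M *ᵥ f t) ⬝ᵥ f')) s t := by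
  have := hasDerivWithinAt_dotProduct hf (hasDerivWithinAt_mulVec M hf)
  convert this using 1
  rw [← dotProduct_transpose_mulVec M f', hM, dotProduct_comm]
  ring

theorem _root_.Matrix.PosDef.exists_norm_sq_le {n : ℕ} {Z : Matrix (Fin n) (Fin n) ℝ}
    (hZ : Z.PosDef) : ∃ c > 0, ∀ x, c * ‖x‖ ^ 2 ≤ x ⬝ᵥ (Z *ᵥ x) := by
  have hmem : ∀ x : Fin n → ℝ, x ≠ 0 → ‖x‖⁻¹ • x ∈ Metric.sphere (0 : Fin n → ℝ) 1 := by
    intro x hx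
    simp [norm_smul, inv_mul_cancel₀ (norm_ne_zero_iff.2 hx)]
  rcases (Metric.sphere (0 : Fin n → ℝ) 1).eq_empty_or_nonempty with he | hne
  · refine ⟨1, one_pos, fun x => ?_⟩
    by_cases hx : x = 0
    · simp [hx]
    · exact absurd (hmem x hx) (by simp [he])
  · obtain ⟨v, hv, hmin⟩ := (isCompact_sphere (0 : Fin n → ℝ) 1).exists_isMinOn hne
      (continuous_dotProduct_mulVec Z).continuousOn
    have hv0 : v ≠ 0 := by rintro rfl; simp at hv
    refine ⟨_, (posDef_iff_real.1 hZ).2 v hv0, fun x => ?_⟩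
    by_cases hx : x = 0
    · simp [hx]
    · have h1 := hmin (hmem x hx)
      have hn := norm_ne_zero_iff.2 hx
      simp only [Set.mem_ofPred_eq, smul_dotProduct_mulVec_smul] at h1
      rwa [inv_pow, inv_mul_eq_div, le_div_iff₀ (by positivity)] at h1

/-- The discontinuities of a function on the time interval `[0, T]`. -/
def discontinuities {k : ℕ} (v : ℝ → Fin k → ℝ) (T : ℝ) : Set ℝ :=
  {t | t ∈ Set.Icc 0 T ∧ ¬ ContinuousWithinAt v (Set.Ici 0) t}

theorem intervalIntegrable_comp {n m : ℕ} {x : ℝ → Fin n → ℝ} {u : ℝ → Fin m → ℝ}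
    (hx : MemLinfty x) (hu : MemLinfty u) {h : (Fin n → ℝ) → (Fin m → ℝ) → ℝ}
    (hh : Continuous fun z : (Fin n → ℝ) × (Fin m → ℝ) => h z.1 z.2) {a b : ℝ} (ha : 0 ≤ a)
    (hab : a ≤ b) : IntervalIntegrable (fun t => h (x t) (u t)) volume a b := by
  obtain ⟨Mx, hMx⟩ := hx.2
  obtain ⟨Mu, hMu⟩ := hu.2
  obtain ⟨M, hM⟩ := ((isCompact_closedBall (0 : Fin n → ℝ) Mx).prod
    (isCompact_closedBall (0 : Fin m → ℝ) Mu)).exists_bound_of_continuousOn hh.continuousOn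
  have hfin : (discontinuities x b ∪ discontinuities u b).Finite :=
    (hx.1.1 b).union (hu.1.1 b)
  have hcont : ContinuousOn (fun t => h (x t) (u t))
      (Set.Ioc a b \ (discontinuities x b ∪ discontinuities u b)) := by
    intro t ht
    have ht0 : t ∈ Set.Icc 0 b := ⟨ha.trans ht.1.1.le, ht.1.2⟩
    have h1 : ContinuousWithinAt x (Set.Ici 0) t := by
      by_contra hc; exact ht.2 (Or.inl ⟨ht0, hc⟩)
    have h2 : ContinuousWithinAt u (Set.Ici 0) t := by
      by_contra hc; exact ht.2 (Or.inr ⟨ht0, hc⟩)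
    refine ContinuousWithinAt.mono (t := Set.Ici 0) ?_ fun s hs => ha.trans hs.1.1.le
    exact hh.continuousAt.comp_continuousWithinAt (h1.prodMk h2)
  rw [intervalIntegrable_iff_integrableOn_Ioc_of_le hab]
  refine IntegrableOn.of_bound (by simp) ?_ M ?_
  · have h1 := hcont.aestronglyMeasurable (μ := volume)
      (measurableSet_Ioc.diff hfin.measurableSet)
    rwa [Measure.restrict_congr_set (sdiff_null_ae_eq_self (hfin.measure_zero volume))] at h1
  · refine (ae_restrict_iff' measurableSet_Ioc).2 (Eventually.of_forall fun t ht => ?_)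
    have ht0 : 0 ≤ t := ha.trans ht.1.le
    exact hM (x t, u t) ⟨by simpa using hMx t ht0, by simpa using hMu t ht0⟩

theorem integral_eq_sub_of_piecewise {m : ℕ} {u : ℝ → Fin m → ℝ} (hu : PiecewiseContinuous u)
    {V V' : ℝ → ℝ} (hV : ContinuousOn V (Set.Ici 0))
    (hd : ∀ t, 0 ≤ t → ContinuousWithinAt u (Set.Ici 0) t →
      HasDerivWithinAt V (V' t) (Set.Ici 0) t) {a b : ℝ} (ha : 0 ≤ a) (hab : a ≤ b)
    (hi : IntervalIntegrable V' volume a b) : ∫ t in a..b, V' t = V b - V a := by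
  refine integral_eq_of_hasDerivAt_off_countable_of_le V V' hab (hu.1 b).countable
    (hV.mono fun t ht => ha.trans ht.1) (fun t ht => ?_) hi
  have ht0 : 0 < t := ha.trans_lt ht.1.1
  have hc : ContinuousWithinAt u (Set.Ici 0) t := by
    by_contra hc; exact ht.2 ⟨⟨ht0.le, ht.1.2.le⟩, hc⟩
  exact (hd t ht0.le hc).hasDerivAt (Ici_mem_nhds ht0)

/-- Increments of the bounded monotone `G` are eventually small. The integral term prevents `N` from
staying above any `ε > 0`, so `N` is small at some late time, and the inequality keeps it small
afterwards. -/
theorem tendsto_zero_of_dissipation {N G : ℝ → ℝ} {c k g : ℝ} (hc : 0 < c) (hk : 0 ≤ k)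
    (hN0 : ∀ t, 0 ≤ t → 0 ≤ N t) (hN : ContinuousOn N (Set.Ici 0))
    (hmono : MonotoneOn G (Set.Ici 0)) (hbdd : ∀ t, 0 ≤ t → G t ≤ g)
    (hdiss : ∀ s T, 0 ≤ s → s ≤ T → N T - N s + c * ∫ t in s..T, N t ≤ k * (G T - G s)) :
    Tendsto N atTop (𝓝 0) := by
  have hint : ∀ s T, 0 ≤ s → s ≤ T → IntervalIntegrable N volume s T := fun s T hs hsT =>
    (hN.mono (by rw [Set.uIcc_of_le hsT]; exact fun t ht => hs.trans ht.1)).intervalIntegrable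
  -- the supremum of `G` is nearly attained
  have hsup : ∀ ε > 0, ∃ s₀, 0 ≤ s₀ ∧ ∀ s T, s₀ ≤ s → s ≤ T → G T - G s ≤ ε := by
    intro ε hε
    have hb : BddAbove (G '' Set.Ici 0) := ⟨g, by rintro _ ⟨t, ht, rfl⟩; exact hbdd t ht⟩
    obtain ⟨_, ⟨s₀, hs₀, rfl⟩, hlt⟩ := exists_lt_of_lt_csSup
      (Set.Nonempty.image G ⟨0, Set.self_mem_Ici⟩) (sub_lt_self (sSup (G '' Set.Ici 0)) hε)
    refine ⟨s₀, hs₀, fun s T hs hsT => ?_⟩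
    have h1 : G T ≤ sSup (G '' Set.Ici 0) :=
      le_csSup hb ⟨T, (hs₀.out.trans hs).trans hsT, rfl⟩
    have h2 := hmono hs₀ (hs₀.out.trans hs : (0 : ℝ) ≤ s) hs
    linarith
  have hsmall : ∀ ε > 0, ∀ s₀, 0 ≤ s₀ → ∃ s, s₀ ≤ s ∧ N s < ε := by
    intro ε hε s₀ hs₀
    by_contra! hcon
    -- With this length, `N ≥ ε` throughout would make `c ∫ N` exceed all that `N s₀` and the
    -- increase of `G` can supply; the `+ 1` makes the excess strict.
    set L := (N s₀ + k * (g - G s₀)) / (c * ε) + 1 with hL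
    have hpos : 0 ≤ (N s₀ + k * (g - G s₀)) / (c * ε) :=
      div_nonneg (add_nonneg (hN0 s₀ hs₀) (mul_nonneg hk (sub_nonneg.2 (hbdd s₀ hs₀))))
        (by positivity)
    have hle : s₀ ≤ s₀ + L := by linarith
    have h1 := hdiss s₀ (s₀ + L) hs₀ hle
    have h2 : L * ε ≤ ∫ t in s₀..(s₀ + L), N t := by
      have := intervalIntegral.integral_mono_on hle (f := fun _ => ε) (g := N) (by simp)
        (hint _ _ hs₀ hle) fun t ht => hcon t ht.1
      simpa using this
    have h3 : k * (G (s₀ + L) - G s₀) ≤ k * (g - G s₀) := by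
      gcongr
      exact hbdd _ (by linarith)
    have h4 := hN0 (s₀ + L) (by linarith)
    have h5 : c * (L * ε) = N s₀ + k * (g - G s₀) + c * ε := by
      rw [hL]; field_simp
    have h6 := mul_le_mul_of_nonneg_left h2 hc.le
    nlinarith [mul_pos hc hε]
  rw [Metric.tendsto_atTop]
  intro ε hε
  obtain ⟨s₀, hs₀, hG⟩ := hsup (ε / (2 * (k + 1))) (by positivity)
  obtain ⟨s, hs, hNs⟩ := hsmall (ε / 2) (by positivity) s₀ hs₀
  refine ⟨s, fun T hT => ?_⟩
  have hs0 := hs₀.trans hs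
  rw [Real.dist_eq, sub_zero, abs_of_nonneg (hN0 T (hs0.trans hT))]
  have h1 := hdiss s T hs0 hT
  have h2 : 0 ≤ ∫ t in s..T, N t :=
    intervalIntegral.integral_nonneg hT fun t ht => hN0 t (hs0.trans ht.1)
  have h3 : k * (G T - G s) ≤ ε / 2 := by
    calc k * (G T - G s) ≤ k * (ε / (2 * (k + 1))) := by
          gcongr
          exact hG s T hs hT
      _ ≤ (k + 1) * (ε / (2 * (k + 1))) := by gcongr; linarith
      _ = ε / 2 := by field_simp
  have h4 := mul_nonneg hc.le h2
  linarith

end Analysis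

/-! ### Completion of squares, convergence and overtaking optimality. -/

section Overtaking

variable {n m p : ℕ} {A Q P : Matrix (Fin n) (Fin n) ℝ} {B : Matrix (Fin n) (Fin m) ℝ}
  {R : Matrix (Fin m) (Fin m) ℝ} {C : Matrix (Fin n) (Fin p) ℝ} {d : Fin p → ℝ}

/-- Completion of squares along the Riccati solution. -/
theorem completion_of_squares (hR : R.PosDef) (hP : Pᵀ = P)
    (hric : riccati A (B * R⁻¹ * Bᵀ) Q P = 0) (e : Fin n → ℝ) (v : Fin m → ℝ) :
    cost Q R e v + (P *ᵥ e) ⬝ᵥ (A *ᵥ e + B *ᵥ v) =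
      1 / 2 * ((v + (R⁻¹ * Bᵀ * P) *ᵥ e) ⬝ᵥ (R *ᵥ (v + (R⁻¹ * Bᵀ * P) *ᵥ e))) := by
  have hRdet : IsUnit R.det := (Matrix.isUnit_iff_isUnit_det _).1 hR.isUnit
  have hRs := (posDef_iff_real.1 hR).1
  set q := Bᵀ *ᵥ (P *ᵥ e) with hq
  have hK : (R⁻¹ * Bᵀ * P) *ᵥ e = R⁻¹ *ᵥ q := by
    rw [hq, Matrix.mulVec_mulVec, Matrix.mulVec_mulVec, Matrix.mul_assoc]
  have hRK : R *ᵥ (R⁻¹ *ᵥ q) = q := by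
    rw [Matrix.mulVec_mulVec, Matrix.mul_nonsing_inv _ hRdet, Matrix.one_mulVec]
  have h1 := dotProduct_riccati (A := A) (S := B * R⁻¹ * Bᵀ) (Q := Q) hP e
  rw [hric, Matrix.zero_mulVec, dotProduct_zero, dotProduct_lyapunov hP,
    dotProduct_inputWeight, ← hq] at h1
  have h2 : (P *ᵥ e) ⬝ᵥ (B *ᵥ v) = v ⬝ᵥ q := by rw [hq, dotProduct_transpose_mulVec]
  have h3 : (R⁻¹ *ᵥ q) ⬝ᵥ (R *ᵥ v) = v ⬝ᵥ q := by
    rw [← dotProduct_transpose_mulVec, hRs, hRK]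
  have h4 : (R⁻¹ *ᵥ q) ⬝ᵥ q = q ⬝ᵥ (R⁻¹ *ᵥ q) := dotProduct_comm _ _
  rw [hK, Matrix.mulVec_add, hRK]
  simp only [cost, dotProduct_add, add_dotProduct, h2, h3, h4]
  linarith

theorem closedLoop_split (e : Fin n → ℝ) (v : Fin m → ℝ) :
    A *ᵥ e + B *ᵥ v =
      (A - (B * R⁻¹ * Bᵀ) * P) *ᵥ e + B *ᵥ (v + (R⁻¹ * Bᵀ * P) *ᵥ e) := by
  rw [Matrix.mulVec_add, Matrix.mulVec_mulVec, Matrix.sub_mulVec]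
  simp only [Matrix.mul_assoc]
  abel

-- A weighted Young inequality, from nonnegativity of the `R`-form at `R⁻¹ Bᵀ y - c w`. The factor
-- `1 / 2` costs only half of the dissipation `(Z e) ⬝ᵥ (Z e)`, leaving the decay rate `c / 2` in
-- the state estimate.
open scoped Matrix.Norms.Operator in
theorem exists_input_bound (B : Matrix (Fin n) (Fin m) ℝ) (hR : R.PosDef) :
    ∃ k ≥ 0, ∀ (y : Fin n → ℝ) (w : Fin m → ℝ),
      2 * (y ⬝ᵥ (B *ᵥ w)) ≤ 1 / 2 * (y ⬝ᵥ y) + k * (w ⬝ᵥ (R *ᵥ w)) := by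
  have hRdet : IsUnit R.det := (Matrix.isUnit_iff_isUnit_det _).1 hR.isUnit
  have hRs := (posDef_iff_real.1 hR).1
  set c : ℝ := 2 * (n * ‖B * R⁻¹ * Bᵀ‖ + 1) with hc
  have hc0 : 0 < c := by positivity
  refine ⟨c, hc0.le, fun y w => ?_⟩
  set q := Bᵀ *ᵥ y with hq
  have h1 := (posSemidef_iff_real.1 hR.posSemidef).2 (R⁻¹ *ᵥ q - c • w)
  have hRK : R *ᵥ (R⁻¹ *ᵥ q) = q := by
    rw [Matrix.mulVec_mulVec, Matrix.mul_nonsing_inv _ hRdet, Matrix.one_mulVec]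
  have h2 : y ⬝ᵥ (B *ᵥ w) = w ⬝ᵥ q := by rw [hq, dotProduct_transpose_mulVec]
  have h3 : (R⁻¹ *ᵥ q) ⬝ᵥ (R *ᵥ w) = w ⬝ᵥ q := by
    rw [← dotProduct_transpose_mulVec, hRs, hRK]
  have h4 := (abs_le.1 (abs_dotProduct_mulVec_le (B * R⁻¹ * Bᵀ) y)).2
  rw [dotProduct_inputWeight, ← hq] at h4
  have h5 : 0 ≤ y ⬝ᵥ y := Finset.sum_nonneg fun i _ => mul_self_nonneg _
  rw [Matrix.mulVec_sub, hRK, Matrix.mulVec_smul] at h1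
  simp only [dotProduct_sub, sub_dotProduct, smul_dotProduct, dotProduct_smul, smul_eq_mul,
    h3] at h1
  rw [dotProduct_comm (R⁻¹ *ᵥ q) q] at h1
  rw [h2]
  have h6 : q ⬝ᵥ (R⁻¹ *ᵥ q) ≤ c * (1 / 2 * (y ⬝ᵥ y)) := by
    rw [hc]; linarith
  have h7 : c * (2 * (w ⬝ᵥ q)) ≤ c * (1 / 2 * (y ⬝ᵥ y) + c * (w ⬝ᵥ (R *ᵥ w))) := by
    linarith
  exact le_of_mul_le_mul_left h7 hc0

theorem IsTrajectory.hasDerivWithinAt_sub {x0 xbar : Fin n → ℝ} {ubar : Fin m → ℝ}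
    {u : ℝ → Fin m → ℝ} {x : ℝ → Fin n → ℝ} (h : IsTrajectory A B C d x0 u x)
    (hbar : A *ᵥ xbar + B *ᵥ ubar + C *ᵥ d = 0) {t : ℝ} (ht : 0 ≤ t)
    (hc : ContinuousWithinAt u (Set.Ici 0) t) :
    HasDerivWithinAt (fun τ => x τ - xbar) (A *ᵥ (x t - xbar) + B *ᵥ (u t - ubar))
      (Set.Ici 0) t := by
  have h1 := (h.2.2.2 t ht hc).sub_const xbar
  refine h1.congr_deriv ?_
  rw [Matrix.mulVec_sub, Matrix.mulVec_sub]
  linear_combination hbar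

theorem IsTrajectory.continuousOn_sub {x0 xbar : Fin n → ℝ}
    {u : ℝ → Fin m → ℝ} {x : ℝ → Fin n → ℝ} (h : IsTrajectory A B C d x0 u x) :
    ContinuousOn (fun τ => x τ - xbar) (Set.Ici 0) :=
  h.2.2.1.sub continuousOn_const

/-- The deviation of an input from the feedback law. -/
noncomputable def feedbackDefect (B : Matrix (Fin n) (Fin m) ℝ) (R : Matrix (Fin m) (Fin m) ℝ)
    (P : Matrix (Fin n) (Fin n) ℝ) (xbar : Fin n → ℝ) (ubar : Fin m → ℝ)
    (x : Fin n → ℝ) (u : Fin m → ℝ) : Fin m → ℝ :=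
  (u - ubar) + (R⁻¹ * Bᵀ * P) *ᵥ (x - xbar)

/-- The accumulated squared deviation from the feedback law. -/
noncomputable def defectIntegral (B : Matrix (Fin n) (Fin m) ℝ) (R : Matrix (Fin m) (Fin m) ℝ)
    (P : Matrix (Fin n) (Fin n) ℝ) (xbar : Fin n → ℝ) (ubar : Fin m → ℝ)
    (x : ℝ → Fin n → ℝ) (u : ℝ → Fin m → ℝ) (T : ℝ) : ℝ :=
  ∫ t in (0 : ℝ)..T, feedbackDefect B R P xbar ubar (x t) (u t) ⬝ᵥ
    (R *ᵥ feedbackDefect B R P xbar ubar (x t) (u t))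

variable {x0 xbar : Fin n → ℝ} {ubar : Fin m → ℝ} {u : ℝ → Fin m → ℝ} {x : ℝ → Fin n → ℝ}

theorem intervalIntegrable_defect (h : IsAdmissible A B C d x0 u x) {s T : ℝ} (hs : 0 ≤ s)
    (hsT : s ≤ T) :
    IntervalIntegrable (fun t => feedbackDefect B R P xbar ubar (x t) (u t) ⬝ᵥ
      (R *ᵥ feedbackDefect B R P xbar ubar (x t) (u t))) volume s T :=
  intervalIntegrable_comp h.2.2 h.2.1
    (h := fun y v => feedbackDefect B R P xbar ubar y v ⬝ᵥ
      (R *ᵥ feedbackDefect B R P xbar ubar y v))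
    (by unfold feedbackDefect; fun_prop) hs hsT

theorem defectIntegral_sub (h : IsAdmissible A B C d x0 u x) {s T : ℝ} (hs : 0 ≤ s)
    (hsT : s ≤ T) :
    defectIntegral B R P xbar ubar x u T - defectIntegral B R P xbar ubar x u s =
      ∫ t in s..T, feedbackDefect B R P xbar ubar (x t) (u t) ⬝ᵥ
        (R *ᵥ feedbackDefect B R P xbar ubar (x t) (u t)) :=
  intervalIntegral.integral_interval_sub_left
    (intervalIntegrable_defect h le_rfl (hs.trans hsT)) (intervalIntegrable_defect h le_rfl hs)

theorem defectIntegral_monotoneOn (hR : R.PosDef) (h : IsAdmissible A B C d x0 u x) :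
    MonotoneOn (defectIntegral B R P xbar ubar x u) (Set.Ici 0) := by
  intro s hs T _ hsT
  rw [← sub_nonneg, defectIntegral_sub h hs hsT]
  exact intervalIntegral.integral_nonneg hsT fun t _ =>
    (posSemidef_iff_real.1 hR.posSemidef).2 _

/-- If the deviation from the feedback law has finite energy, the state converges. -/
theorem tendsto_of_defectIntegral_bounded (hdet : HautusTest Aᵀ Qᵀ) (hQ : Q.PosSemidef)
    (hR : R.PosDef) (hP : P.PosSemidef) (hric : riccati A (B * R⁻¹ * Bᵀ) Q P = 0)
    (hbar : A *ᵥ xbar + B *ᵥ ubar + C *ᵥ d = 0) (h : IsAdmissible A B C d x0 u x) {g : ℝ}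
    (hg : ∀ t, 0 ≤ t → defectIntegral B R P xbar ubar x u t ≤ g) :
    Tendsto x atTop (𝓝 xbar) := by
  obtain ⟨Z, hZ, hZF, c, hc, hcZ⟩ := exists_lyapunov
    (closedLoop_hautusTest hdet (inputWeight_posSemidef hR) hQ hP hric)
  obtain ⟨k, hk, hkB⟩ := exists_input_bound B hR
  obtain ⟨hZs, -⟩ := posDef_iff_real.1 hZ
  have hcont := h.1.continuousOn_sub (xbar := xbar)
  have hNc : ContinuousOn (fun t => (x t - xbar) ⬝ᵥ (Z *ᵥ (x t - xbar))) (Set.Ici 0) :=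
    (continuous_dotProduct_mulVec Z).comp_continuousOn hcont
  have hN : Tendsto (fun t => (x t - xbar) ⬝ᵥ (Z *ᵥ (x t - xbar))) atTop (𝓝 0) := by
    refine tendsto_zero_of_dissipation (c := c / 2) (k := k) (half_pos hc) hk
      (fun t _ => (posSemidef_iff_real.1 hZ.posSemidef).2 _) hNc
      (defectIntegral_monotoneOn hR h) hg fun s T hs hsT => ?_
    have hint : ∀ {f : (Fin n → ℝ) → (Fin m → ℝ) → ℝ},
        (Continuous fun z : (Fin n → ℝ) × (Fin m → ℝ) => f z.1 z.2) →
        IntervalIntegrable (fun t => f (x t) (u t)) volume s T :=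
      fun hf => intervalIntegrable_comp h.2.2 h.2.1 hf hs hsT
    have hNi := hint (f := fun y _ => (y - xbar) ⬝ᵥ (Z *ᵥ (y - xbar))) (by fun_prop)
    have hwi := intervalIntegrable_defect (R := R) (P := P) (xbar := xbar) (ubar := ubar) h hs hsT
    have hdi := hint (f := fun y v => 2 * ((Z *ᵥ (y - xbar)) ⬝ᵥ
      (A *ᵥ (y - xbar) + B *ᵥ (v - ubar)))) (by fun_prop)
    have hftc := integral_eq_sub_of_piecewise h.1.1 hNc
      (fun t ht htc => hasDerivWithinAt_quadratic hZs (h.1.hasDerivWithinAt_sub hbar ht htc))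
      hs hsT hdi
    rw [← hftc, defectIntegral_sub h hs hsT, ← intervalIntegral.integral_const_mul,
      ← intervalIntegral.integral_const_mul,
      ← intervalIntegral.integral_add hdi (hNi.const_mul _)]
    refine intervalIntegral.integral_mono_on hsT (hdi.add (hNi.const_mul _))
      (hwi.const_mul _) fun t _ => ?_
    have h1 := hkB (Z *ᵥ (x t - xbar)) (feedbackDefect B R P xbar ubar (x t) (u t))
    have h2 := hZF (x t - xbar)
    have h3 := hcZ (x t - xbar)
    rw [closedLoop_split (R := R) (P := P), dotProduct_add, mul_add, h2]
    unfold feedbackDefect at h1 ⊢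
    linarith
  obtain ⟨c', hc', hle⟩ := hZ.exists_norm_sq_le
  rw [tendsto_iff_norm_sub_tendsto_zero]
  have h1 : Tendsto (fun t => ‖x t - xbar‖ ^ 2) atTop (𝓝 0) := by
    have h2 := hN.const_mul c'⁻¹
    rw [mul_zero] at h2
    refine squeeze_zero (fun t => sq_nonneg _) (fun t => ?_) h2
    rw [inv_mul_eq_div, le_div_iff₀ hc', mul_comm]
    exact hle _
  have h3 := h1.sqrt
  simpa using h3

/-- The value of the performance index along an admissible control. -/
theorem performanceIndex_eq (hQ : Q.PosSemidef)
    (hR : R.PosDef) (hP : P.PosSemidef) (hric : riccati A (B * R⁻¹ * Bᵀ) Q P = 0)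
    (hbar : A *ᵥ xbar + B *ᵥ ubar + C *ᵥ d = 0) {l : Fin n → ℝ}
    (hy : Q *ᵥ xbar = -(Aᵀ *ᵥ l)) (hu : R *ᵥ ubar = -(Bᵀ *ᵥ l))
    (h : IsAdmissible A B C d x0 u x) {T : ℝ} (hT : 0 ≤ T) :
    performanceIndex Q R x u T = T * cost Q R xbar ubar +
      1 / 2 * defectIntegral B R P xbar ubar x u T +
      (1 / 2 * ((x0 - xbar) ⬝ᵥ (P *ᵥ (x0 - xbar))) + l ⬝ᵥ (x0 - xbar)) -
      (1 / 2 * ((x T - xbar) ⬝ᵥ (P *ᵥ (x T - xbar))) + l ⬝ᵥ (x T - xbar)) := by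
  obtain ⟨hPs, -⟩ := posSemidef_iff_real.1 hP
  have hcont := h.1.continuousOn_sub (xbar := xbar)
  have hint : ∀ {f : (Fin n → ℝ) → (Fin m → ℝ) → ℝ},
      (Continuous fun z : (Fin n → ℝ) × (Fin m → ℝ) => f z.1 z.2) →
      IntervalIntegrable (fun t => f (x t) (u t)) volume 0 T :=
    fun hf => intervalIntegrable_comp h.2.2 h.2.1 hf le_rfl hT
  have hVc : ContinuousOn (fun t => 1 / 2 * ((x t - xbar) ⬝ᵥ (P *ᵥ (x t - xbar))) +
      l ⬝ᵥ (x t - xbar)) (Set.Ici 0) :=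
    Continuous.comp_continuousOn (g := fun e : Fin n → ℝ => 1 / 2 * (e ⬝ᵥ (P *ᵥ e)) + l ⬝ᵥ e)
      (by fun_prop) hcont
  have hdi := hint (f := fun y v => (P *ᵥ (y - xbar)) ⬝ᵥ
      (A *ᵥ (y - xbar) + B *ᵥ (v - ubar)) + l ⬝ᵥ (A *ᵥ (y - xbar) + B *ᵥ (v - ubar)))
      (by fun_prop)
  have hwi := intervalIntegrable_defect (R := R) (P := P) (xbar := xbar) (ubar := ubar) h le_rfl hT
  have hftc := integral_eq_sub_of_piecewise h.1.1 hVc (fun t ht htc => by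
      have h1 := h.1.hasDerivWithinAt_sub hbar ht htc
      have h2 := ((hasDerivWithinAt_quadratic hPs h1).const_mul (1 / 2)).add
        (hasDerivWithinAt_dotProduct (hasDerivWithinAt_const t (Set.Ici 0) l) h1)
      refine h2.congr_deriv ?_
      rw [zero_dotProduct, zero_add, ← mul_assoc]
      norm_num) le_rfl hT hdi
  have hpt : ∀ t, cost Q R (x t) (u t) = cost Q R xbar ubar +
      1 / 2 * (feedbackDefect B R P xbar ubar (x t) (u t) ⬝ᵥ
        (R *ᵥ feedbackDefect B R P xbar ubar (x t) (u t))) -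
      ((P *ᵥ (x t - xbar)) ⬝ᵥ (A *ᵥ (x t - xbar) + B *ᵥ (u t - ubar)) +
        l ⬝ᵥ (A *ᵥ (x t - xbar) + B *ᵥ (u t - ubar))) := by
    intro t
    have h1 := cost_expand (posSemidef_iff_real.1 hQ).1 (posDef_iff_real.1 hR).1 hy hu
      (x t - xbar) (u t - ubar)
    have h2 := completion_of_squares hR hPs hric (x t - xbar) (u t - ubar)
    rw [add_sub_cancel, add_sub_cancel] at h1
    unfold feedbackDefect
    linarith
  unfold performanceIndex
  simp_rw [hpt]
  rw [intervalIntegral.integral_sub ((intervalIntegrable_const).add (hwi.const_mul _)) hdi,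
    intervalIntegral.integral_add intervalIntegrable_const (hwi.const_mul _), hftc,
    intervalIntegral.integral_const, intervalIntegral.integral_const_mul, h.1.2.1]
  simp only [defectIntegral, smul_eq_mul, sub_zero]
  ring

theorem feedbackDefect_feedback (xs : ℝ → Fin n → ℝ) (t : ℝ) :
    feedbackDefect B R P xbar ubar (xs t) (feedback B R P xbar ubar xs t) = 0 := by
  simp [feedbackDefect, feedback]

theorem piecewiseContinuous_of_continuousOn {k : ℕ} {v : ℝ → Fin k → ℝ}
    (hv : ContinuousOn v (Set.Ici 0)) : PiecewiseContinuous v := by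
  refine ⟨fun T => ?_, fun t ht => ⟨v t, ?_⟩, fun t ht => ⟨v t, ?_⟩⟩
  · convert Set.finite_empty
    rw [Set.eq_empty_iff_forall_notMem]
    exact fun t ht => ht.2 (hv t ht.1.1)
  · exact (hv t ht).mono fun s hs => ht.trans (le_of_lt hs)
  · exact ((hv t ht.le).continuousAt (Ici_mem_nhds ht)).continuousWithinAt

theorem continuousOn_feedback {xs : ℝ → Fin n → ℝ} (h : ContinuousOn xs (Set.Ici 0)) :
    ContinuousOn (feedback B R P xbar ubar xs) (Set.Ici 0) :=
  Continuous.comp_continuousOn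
    (g := fun y : Fin n → ℝ => -((R⁻¹ * Bᵀ * P) *ᵥ (y - xbar)) + ubar) (by fun_prop) h

/-- The Lyapunov form of `xs - xbar` decreases along the closed loop, so the trajectory stays in a
compact ball and its continuous feedback is bounded. -/
theorem feedback_isAdmissible (hdet : HautusTest Aᵀ Qᵀ) (hQ : Q.PosSemidef)
    (hR : R.PosDef) (hP : P.PosSemidef) (hric : riccati A (B * R⁻¹ * Bᵀ) Q P = 0)
    (hbar : A *ᵥ xbar + B *ᵥ ubar + C *ᵥ d = 0) {xs : ℝ → Fin n → ℝ}
    (h : IsTrajectory A B C d x0 (feedback B R P xbar ubar xs) xs) :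
    IsAdmissible A B C d x0 (feedback B R P xbar ubar xs) xs := by
  obtain ⟨Z, hZ, hZF, -⟩ := exists_lyapunov
    (closedLoop_hautusTest hdet (inputWeight_posSemidef hR) hQ hP hric)
  obtain ⟨hZs, -⟩ := posDef_iff_real.1 hZ
  obtain ⟨c, hc, hle⟩ := hZ.exists_norm_sq_le
  have huc := continuousOn_feedback (B := B) (R := R) (P := P) (xbar := xbar) (ubar := ubar)
    h.2.2.1
  have hanti : AntitoneOn (fun t => (xs t - xbar) ⬝ᵥ (Z *ᵥ (xs t - xbar))) (Set.Ici 0) := by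
    refine antitoneOn_of_hasDerivWithinAt_nonpos (convex_Ici 0)
      ((continuous_dotProduct_mulVec Z).comp_continuousOn h.continuousOn_sub)
      (fun t ht => (hasDerivWithinAt_quadratic hZs (h.hasDerivWithinAt_sub hbar
        (interior_subset ht) (huc t (interior_subset ht)))).mono interior_subset)
      fun t ht => ?_
    have h0 := feedbackDefect_feedback (B := B) (R := R) (P := P) (xbar := xbar) (ubar := ubar)
      xs t
    unfold feedbackDefect at h0
    rw [closedLoop_split (R := R) (P := P), h0, Matrix.mulVec_zero, add_zero, hZF, neg_nonpos]
    exact Finset.sum_nonneg fun i _ => mul_self_nonneg _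
  set r := √(c⁻¹ * ((xs 0 - xbar) ⬝ᵥ (Z *ᵥ (xs 0 - xbar)))) with hr
  have hball : ∀ t, 0 ≤ t → xs t ∈ Metric.closedBall xbar r := by
    intro t ht
    rw [mem_closedBall_iff_norm]
    refine Real.le_sqrt_of_sq_le ?_
    rw [inv_mul_eq_div, le_div_iff₀ hc, mul_comm]
    exact (hle _).trans (hanti Set.self_mem_Ici ht ht)
  obtain ⟨M₁, hM₁⟩ := (isCompact_closedBall xbar r).exists_bound_of_continuousOn
    (f := fun y => y) continuousOn_id
  obtain ⟨M₂, hM₂⟩ := (isCompact_closedBall xbar r).exists_bound_of_continuousOn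
    (f := fun y : Fin n → ℝ => -((R⁻¹ * Bᵀ * P) *ᵥ (y - xbar)) + ubar)
    (Continuous.continuousOn (by fun_prop))
  exact ⟨h, ⟨piecewiseContinuous_of_continuousOn huc, M₂, fun t ht => hM₂ _ (hball t ht)⟩,
    ⟨piecewiseContinuous_of_continuousOn h.2.2.1, M₁, fun t ht => hM₁ _ (hball t ht)⟩⟩

theorem exists_feedback_trajectory (A : Matrix (Fin n) (Fin n) ℝ) (R : Matrix (Fin m) (Fin m) ℝ)
    (P : Matrix (Fin n) (Fin n) ℝ) (hbar : A *ᵥ xbar + B *ᵥ ubar + C *ᵥ d = 0)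
    (x0 : Fin n → ℝ) :
    ∃ xs : ℝ → Fin n → ℝ, IsTrajectory A B C d x0 (feedback B R P xbar ubar xs) xs := by
  let F : (Fin n → ℝ) →L[ℝ] (Fin n → ℝ) :=
    LinearMap.toContinuousLinearMap (Matrix.toLin' (A - (B * R⁻¹ * Bᵀ) * P))
  let xs : ℝ → Fin n → ℝ := fun t => xbar + NormedSpace.exp (t • F) (x0 - xbar)
  have hd : ∀ t, HasDerivAt xs (F (xs t - xbar)) t := by
    intro t
    have h1 := (hasDerivAt_exp_smul_const' F t).clm_apply (hasDerivAt_const t (x0 - xbar))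
    have h2 := h1.const_add xbar
    refine h2.congr_deriv ?_
    simp [xs]
  have hc : Continuous xs := continuous_iff_continuousAt.2 fun t => (hd t).continuousAt
  refine ⟨xs, piecewiseContinuous_of_continuousOn (continuousOn_feedback hc.continuousOn),
    by simp [xs], hc.continuousOn, fun t _ _ => (hd t).hasDerivWithinAt.congr_deriv ?_⟩
  have h1 := closedLoop_split (A := A) (B := B) (R := R) (P := P) (xs t - xbar)
    (feedback B R P xbar ubar xs t - ubar)
  have h0 := feedbackDefect_feedback (B := B) (R := R) (P := P) (xbar := xbar) (ubar := ubar)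
    xs t
  unfold feedbackDefect at h0
  rw [h0, Matrix.mulVec_zero, add_zero, Matrix.mulVec_sub, Matrix.mulVec_sub] at h1
  show (A - (B * R⁻¹ * Bᵀ) * P) *ᵥ (xs t - xbar) = _
  rw [← h1]
  linear_combination -hbar

theorem feedback_isOvertakingOptimal (hdet : HautusTest Aᵀ Qᵀ) (hQ : Q.PosSemidef)
    (hR : R.PosDef) (hP : P.PosSemidef) (hric : riccati A (B * R⁻¹ * Bᵀ) Q P = 0)
    (hbar : A *ᵥ xbar + B *ᵥ ubar + C *ᵥ d = 0) {l : Fin n → ℝ}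
    (hy : Q *ᵥ xbar = -(Aᵀ *ᵥ l)) (hu : R *ᵥ ubar = -(Bᵀ *ᵥ l)) {xs : ℝ → Fin n → ℝ}
    (h : IsTrajectory A B C d x0 (feedback B R P xbar ubar xs) xs) :
    IsOvertakingOptimal A B C d Q R x0 (feedback B R P xbar ubar xs) xs := by
  have hadm := feedback_isAdmissible hdet hQ hR hP hric hbar h
  have hG0 : ∀ T, defectIntegral B R P xbar ubar xs (feedback B R P xbar ubar xs) T = 0 := by
    intro T
    simp [defectIntegral, feedbackDefect_feedback]
  let V : (Fin n → ℝ) → ℝ := fun y => 1 / 2 * ((y - xbar) ⬝ᵥ (P *ᵥ (y - xbar))) + l ⬝ᵥ (y - xbar)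
  have hV : Continuous V := by fun_prop
  have hV0 : V xbar = 0 := by simp [V]
  have hVlim : ∀ {y : ℝ → Fin n → ℝ}, Tendsto y atTop (𝓝 xbar) →
      Tendsto (fun T => V (y T)) atTop (𝓝 0) := fun hlim =>
    hV0 ▸ (hV.tendsto xbar).comp hlim
  have hs0 : Tendsto (fun T => V (xs T)) atTop (𝓝 0) :=
    hVlim (tendsto_of_defectIntegral_bounded hdet hQ hR hP hric hbar hadm (g := 0)
      fun t _ => (hG0 t).le)
  refine ⟨hadm, fun u x hx => ?_⟩
  set G := defectIntegral B R P xbar ubar x u with hG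
  have hdiff : ∀ T, 0 ≤ T → performanceIndex Q R xs (feedback B R P xbar ubar xs) T -
      performanceIndex Q R x u T = V (x T) - V (xs T) - 1 / 2 * G T := by
    intro T hT
    rw [performanceIndex_eq hQ hR hP hric hbar hy hu hadm hT,
      performanceIndex_eq hQ hR hP hric hbar hy hu hx hT, hG0]
    simp only [V, hG]
    ring
  have hmono := defectIntegral_monotoneOn (P := P) (xbar := xbar) (ubar := ubar) hR hx
  by_cases hbdd : ∃ g, ∀ t, 0 ≤ t → G t ≤ g
  · obtain ⟨g, hg⟩ := hbdd
    have hx0 := hVlim (tendsto_of_defectIntegral_bounded hdet hQ hR hP hric hbar hx hg)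
    have hlim : Tendsto (fun T => ((V (x T) - V (xs T) : ℝ) : EReal)) atTop (𝓝 0) := by
      have h1 := hx0.sub hs0
      rw [sub_zero] at h1
      exact_mod_cast (continuous_coe_real_ereal.tendsto 0).comp h1
    rw [← hlim.limsup_eq]
    refine limsup_le_limsup ?_
    filter_upwards [eventually_ge_atTop 0] with T hT
    rw [hdiff T hT, EReal.coe_le_coe_iff]
    have h0 : 0 ≤ G T := by
      have : G 0 ≤ G T := hmono Set.self_mem_Ici hT hT
      rwa [show G 0 = 0 from intervalIntegral.integral_same] at this
    linarith
  · push Not at hbdd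
    obtain ⟨M, hM⟩ := hx.2.2.2
    obtain ⟨b, hb⟩ := (isCompact_closedBall (0 : Fin n → ℝ) M).exists_bound_of_continuousOn
      hV.continuousOn
    refine limsup_le_of_le (h := ?_)
    -- Since `V (x T) ≤ b` and eventually `V (xs T) > -1`, a defect above `2 (b + 1)` makes the
    -- difference negative.
    obtain ⟨s, hs0', hs⟩ := hbdd (2 * (b + 1))
    have hev : ∀ᶠ T in atTop, -1 < V (xs T) := hs0.eventually_const_lt (by norm_num)
    filter_upwards [eventually_ge_atTop s, hev] with T hT hVT
    have hT0 := hs0'.trans hT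
    rw [hdiff T hT0, ← EReal.coe_zero, EReal.coe_le_coe_iff]
    have h1 := hmono hs0' hT0 hT
    have h2 := (abs_le.1 (hb (x T) (by simpa using hM T hT0))).2
    linarith

end Overtaking

end OvertakingLQ

theorem mainTheorem1 {n m p : ℕ}
    (A : Matrix (Fin n) (Fin n) ℝ) (B : Matrix (Fin n) (Fin m) ℝ)
    (C : Matrix (Fin n) (Fin p) ℝ) (d : Fin p → ℝ)
    (Q : Matrix (Fin n) (Fin n) ℝ) (R : Matrix (Fin m) (Fin m) ℝ)
    (hQ : Q.PosSemidef) (hR : R.PosDef)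
    (hstab : IsStabilizable A B) (hdet : IsDetectable A Q) :
    (∃! z : (Fin n → ℝ) × (Fin m → ℝ), IsOptimalSteadyState A B C d Q R z.1 z.2) ∧
    (∃! P : Matrix (Fin n) (Fin n) ℝ, IsPSDRiccatiSolution A B Q R P) ∧
    ∀ (xbar : Fin n → ℝ) (ubar : Fin m → ℝ) (P : Matrix (Fin n) (Fin n) ℝ),
      IsOptimalSteadyState A B C d Q R xbar ubar → IsPSDRiccatiSolution A B Q R P →
      ∀ x0 : Fin n → ℝ,
        (∃ xs : ℝ → Fin n → ℝ,
          IsTrajectory A B C d x0 (feedback B R P xbar ubar xs) xs) ∧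
        ∀ xs : ℝ → Fin n → ℝ,
          IsTrajectory A B C d x0 (feedback B R P xbar ubar xs) xs →
          IsOvertakingOptimal A B C d Q R x0 (feedback B R P xbar ubar xs) xs := by
  have hs := hstab.hautusTest
  have hd : HautusTest Aᵀ Qᵀ := IsStabilizable.hautusTest hdet
  obtain ⟨y, u, l, hyu, hy, hu⟩ := exists_lagrange hs hd hQ hR C d
  obtain ⟨hopt, huniq⟩ := steadyState_unique_of_lagrange hd hQ hR hyu hy hu
  refine ⟨⟨(y, u), hopt, fun z hz => Prod.ext (huniq _ _ hz).1 (huniq _ _ hz).2⟩,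
    existsUnique_riccati hs hd hQ hR, fun xbar ubar P hbar hP x0 => ?_⟩
  obtain ⟨rfl, rfl⟩ := huniq _ _ hbar
  have hric : riccati A (B * R⁻¹ * Bᵀ) Q P = 0 := by
    rw [← hP.2]
    simp only [riccati, Matrix.mul_assoc]
  exact ⟨exists_feedback_trajectory A R P hyu x0, fun xs hxs =>
    feedback_isOvertakingOptimal hd hQ hR hP.1 hric hyu hy hu hxs⟩
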